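/- Fix $n\ge 0$ and a partition $\lambda=(\lambda_1\ge\dots\ge\lambda_n\ge 0)$, and let $r=\lambda_1$ ($r=0$ if $n=0$), $m_i(\lambda)=\#\{k:\lambda_k=i\}$, $\lambda'_i=\#\{k:\lambda_k\ge i\}$. Let $q,t,u,v\in\mathbb{C}$. **Operators.** For $1\le i,j\le r$ let $\mathcal F_i^{(j)}$ be the vector space with basis $|m\rangle$, $m\ge 0$, and operators $\phi|m\rangle=(1-t^m)|m-1\rangle$, $\phi^\dagger|m\rangle=|m+1\rangle$, $k|m\rangle=t^m|m\rangle$, $k^{\alpha}|m\rangle=q^m|m\rangle$. On $\mathcal F=\bigotimes_{i,j}\mathcal F_i^{(j)}$ write $\phi_i^{(j)},\phi_i^{\dagger(j)},k_i^{(j)}$ for the operators acting in the factor $(i,j)$. Let $L(x)$ be the $(r+1)\times(r+1)$ matrix with rows and columns indexed by $0,\dots,r$ and, for $1\le i,j\le r$, $$L_{00}=1-ux\prod_{l=1}^r k_l,\quad L_{0j}=\Big(1-uv\prod_{l=1}^r k_l\Big)\phi_j,\quad L_{i0}=x\Big(\prod_{l>i}k_l\Big)\phi_i^\dagger,$$ $$L_{ii}=(x-vk_i)\prod_{l>i}k_l,\quad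 L_{ij}=x\Big(\prod_{l>i}k_l\Big)\phi_i^\dagger\phi_j\ (i>j),\quad L_{ij}=v\Big(\prod_{l>i}k_l\Big)\phi_i^\dagger\phi_j\ (i<j),$$ and let $L^{(j)}(x)$ be its copy built from the operators with superscript $(j)$. Put $T(x)=L^{(1)}(x)\cdots L^{(r)}(x)$, $A_i(x)=T_{i0}(x)$, $A(x)=\sum_{i=0}^r A_i(x)$ and $\mathbb S=\prod_{1\le j<l\le r}\big(k_l^{(j)}\big)^{(l-j)\alpha}$. **Linear form.** For $d=(d_1,\dots,d_r)\in\mathbb{Z}_{\ge0}^r$ and an operator $X$ on $\mathcal F$ let $\langle X\rangle_d$ be obtained by taking the trace over $\mathcal F_i^{(j)}$ for $i>j$, the vacuum expectation value $\langle 0|\cdot|0\rangle$ over $\mathcal F_i^{(j)}$ for $i<j$, and $\langle d_i|\cdot|0\rangle$ over $\mathcal F_i^{(i)}$; put $\rho(X)=\sum_{d}\langle X\rangle_d$. For $\mu\in\{0,\dots,r\}^n$ define $$f_\mu(x_1,\dots,x_n)=\rho\big(A_{\mu_1}(x_1)\cdots A_{\mu_n}(x_n)\,\mathbb S\big),\qquad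 P_\lambda(x;q,t;u,v)=\Omega_\lambda(q,t)\sum_{\mu}f_\mu(x),$$ where the sum is over the distinct rearrangements $\mu$ of $\lambda$ and $\Omega_\lambda(q,t)=\prod_{1\le i<j\le r}\big(1-q^{j-i}t^{\lambda'_i-\lambda'_j}\big)$. **Theorem.** 1. $[A(x),A(y)]=0$ for all $t,u,v,x,y\in\mathbb{C}$. 2. Let $|q|<1$ and $|q|\,|t|^{2n}<1$, with $u,v\in\mathbb C$ arbitrary. Then for all $x\in\mathbb C^n$ the sums defining $\rho$ converge absolutely for $X=A_{\mu_1}(x_1)\cdots A_{\mu_n}(x_n)\mathbb S$ (every $\mu\in\{0,\dots,r\}^n$) and for $X=A(x_1)\cdots A(x_n)\mathbb S$. With $m=(m_1(\lambda),\dots,m_r(\lambda))$: $\langle A_{\mu_1}(x_1)\cdots A_{\mu_n}(x_n)\mathbb S\rangle_m$ equals $f_\mu(x)$ if $\mu$ is a rearrangement of $\lambda$ and $0$ otherwise, and $$P_\lambda(x;q,t;u,v)=\Omega_\lambda(q,t)\,\big\langle A(x_1)\cdots A(x_n)\,\mathbb S\big\rangle_m .$$ Moreover, with $T_i=t-\frac{tx_i-x_{i+1}}{x_i-x_{i+1}}(1-\sigma_i)$,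 where $\sigma_i$ exchanges $x_i$ and $x_{i+1}$, and with $s_i\mu$ obtained from $\mu$ by exchanging $\mu_i$ and $\mu_{i+1}$, every rearrangement $\mu$ of $\lambda$ satisfies $T_if_\mu=f_{s_i\mu}$ if $\mu_i>\mu_{i+1}$ and $T_if_\mu=t\,f_{s_i\mu}$ if $\mu_i=\mu_{i+1}$ (at all points with $x_i\ne x_{i+1}$). 3. The functions $f_\mu$ ($\mu$ a rearrangement of $\lambda$) and $P_\lambda$ are polynomials in $x_1,\dots,x_n$ whose coefficients are rational in $(q,t)$ and polynomial in $(u,v)$, and $P_\lambda$ is symmetric: there are $D\in\mathbb{C}[q,t]$, nowhere zero on the region $|q|<1$, $|q||t|^{2n}<1$, and polynomials $F_\mu,\widehat P\in\mathbb{C}[q,t,u,v][x_1,\dots,x_n]$, with $\widehat P$ symmetric in $x_1,\dots,x_n$, such that $f_\mu=F_\mu/D$ and $P_\lambda=\widehat P/D$ for all $(q,t)$ in the region and all $u,v\in\mathbb{C}$, $x\in\mathbb C^n$. -/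

import Mathlib

noncomputable section

namespace TBoson

/-! ### The Fock space of `r ^ 2` commuting `t`-bosons -/

/-- Occupation numbers of the bosons: `m (i, j)` is the occupation number of family `i` in copy
`j`. Families and copies are numbered from `0`, so `(i, j)` is the boson usually written with
subscript `i + 1` and superscript `j + 1`. -/
abbrev State (r : ℕ) : Type := Fin r × Fin r → ℕ

/-- The Fock space of all `r ^ 2` bosons: the free vector space on the kets `|m⟩`. -/
abbrev Fock (r : ℕ) : Type := State r →₀ ℂ

/-- The ket `|m⟩`. -/
def ket {r : ℕ} (m : State r) : Fock r := Finsupp.single m 1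

/-- The operator with prescribed values on the kets. -/
def opOfKets {r : ℕ} (F : State r → Fock r) : Module.End ℂ (Fock r) :=
  Finsupp.linearCombination ℂ F

/-- The annihilation operator `φ`: `φ |m⟩ = (1 - t ^ m) |m - 1⟩` (zero for `m = 0`). -/
def phi {r : ℕ} (t : ℂ) (p : Fin r × Fin r) : Module.End ℂ (Fock r) :=
  opOfKets fun m => (1 - t ^ m p) • ket (Function.update m p (m p - 1))

/-- The creation operator `φ†`: `φ† |m⟩ = |m + 1⟩`. -/
def phiDag {r : ℕ} (p : Fin r × Fin r) : Module.End ℂ (Fock r) :=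
  opOfKets fun m => ket (Function.update m p (m p + 1))

/-- The operator `k`: `k |m⟩ = t ^ m |m⟩`. With `q = t ^ α` in place of `t` this is `k ^ α`. -/
def kOp {r : ℕ} (t : ℂ) (p : Fin r × Fin r) : Module.End ℂ (Fock r) :=
  opOfKets fun m => (t ^ m p) • ket m

/-- The product of the operators `k` over all families of copy `j`. -/
def kAll {r : ℕ} (t : ℂ) (j : Fin r) : Module.End ℂ (Fock r) :=
  ((List.finRange r).map fun l => kOp t (l, j)).prod

/-- The product of the operators `k` over the families `l > i` of copy `j`. -/
def kAbove {r : ℕ} (t : ℂ) (i j : Fin r) : Module.End ℂ (Fock r) :=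
  (((List.finRange r).filter fun l => i < l).map fun l => kOp t (l, j)).prod

/-! ### The `L`-matrix, the monodromy matrix and the operators `A_i(x)` -/

/-- The `(r + 1) × (r + 1)` matrix `L(x)` built from the bosons of copy `c`. Row and column index
`0` is `0`, and the index `i.succ` corresponds to the boson family `i`. -/
def LMat {r : ℕ} (t u v x : ℂ) (c : Fin r) :
    Matrix (Fin (r + 1)) (Fin (r + 1)) (Module.End ℂ (Fock r)) :=
  Matrix.of fun a b =>
    Fin.cases
      (Fin.cases
        (1 - (u * x) • kAll t c)
        (fun j => (1 - (u * v) • kAll t c) * phi t (j, c)) b)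
      (fun i => Fin.cases
        (x • (kAbove t i c * phiDag (i, c)))
        (fun j =>
          if i = j then (x • 1 - v • kOp t (i, c)) * kAbove t i c
          else if j < i then x • (kAbove t i c * phiDag (i, c) * phi t (j, c))
          else v • (kAbove t i c * phiDag (i, c) * phi t (j, c))) b) a

/-- The monodromy matrix `T(x) = L⁽¹⁾(x) ⋯ L⁽ʳ⁾(x)`. -/
def monodromy (r : ℕ) (t u v x : ℂ) :
    Matrix (Fin (r + 1)) (Fin (r + 1)) (Module.End ℂ (Fock r)) :=
  ((List.finRange r).map fun c => LMat t u v x c).prod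

/-- `A_i(x)`: the entries of the first column of the monodromy matrix. -/
def opA (r : ℕ) (t u v : ℂ) (i : Fin (r + 1)) (x : ℂ) : Module.End ℂ (Fock r) :=
  monodromy r t u v x i 0

/-- `A(x) = ∑ i, A_i(x)`. -/
def opASum (r : ℕ) (t u v : ℂ) (x : ℂ) : Module.End ℂ (Fock r) :=
  ∑ i, opA r t u v i x

/-- The twist `S⁽ʲ⁾ = ∏_{l > j} (k_l^{(l - j) α})⁽ʲ⁾`, where `t ^ α = q`. -/
def twistCopy {r : ℕ} (q : ℂ) (j : Fin r) : Module.End ℂ (Fock r) :=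
  (((List.finRange r).filter fun l => j < l).map
    fun l => kOp q (l, j) ^ ((l : ℕ) - (j : ℕ))).prod

/-- The twist `𝕊 = S⁽¹⁾ ⋯ S⁽ʳ⁾`. -/
def twist (r : ℕ) (q : ℂ) : Module.End ℂ (Fock r) :=
  ((List.finRange r).map fun j => twistCopy q j).prod

/-- `A_{μ₁}(x₁) ⋯ A_{μₙ}(xₙ) 𝕊`. -/
def word {n : ℕ} (r : ℕ) (q t u v : ℂ) (μ : Fin n → Fin (r + 1)) (x : Fin n → ℂ) :
    Module.End ℂ (Fock r) :=
  (List.ofFn fun k => opA r t u v (μ k) (x k)).prod * twist r q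

/-- `A(x₁) ⋯ A(xₙ) 𝕊`. -/
def wordSum {n : ℕ} (r : ℕ) (q t u v : ℂ) (x : Fin n → ℂ) : Module.End ℂ (Fock r) :=
  (List.ofFn fun k => opASum r t u v (x k)).prod * twist r q

/-! ### The linear form -/

/-- The matrix element `⟨b| X |a⟩`. -/
def matrixElement {r : ℕ} (X : Module.End ℂ (Fock r)) (b a : State r) : ℂ := X (ket a) b

/-- Occupation numbers of the bosons that are traced over: those of family `i` and copy `j`
with `i > j`. -/
abbrev TracedConf (r : ℕ) : Type := {p : Fin r × Fin r // p.2 < p.1} → ℕ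

/-- The state with occupation numbers `c` for the traced bosons (family > copy), `d` for the
diagonal ones (family = copy), and `0` for the remaining ones (family < copy). -/
def stateOf {r : ℕ} (d : Fin r → ℕ) (c : TracedConf r) : State r := fun p =>
  if h : p.2 < p.1 then c ⟨p, h⟩ else if p.1 = p.2 then d p.1 else 0

/-- The summand with index `(d, c)`: the bra is `⟨d|` and the ket is `|0⟩` for the diagonal bosons,
bra and ket are both given by `c` for the traced bosons, and both are the vacuum for the others. -/
def formTerm {r : ℕ} (X : Module.End ℂ (Fock r)) (d : Fin r → ℕ) (c : TracedConf r) : ℂ :=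
  matrixElement X (stateOf d c) (stateOf 0 c)

/-- `∏_i ⟨0, …, 0, d_i|⁽ⁱ⁾ Tr[X]⁽ⁱ⁾_{(i, …, r]} |0, …, 0⟩⁽ⁱ⁾`: trace over the bosons with
family > copy, vacuum expectation value for the bosons with family < copy, and `⟨d_i| ⋯ |0⟩` for
the diagonal bosons. -/
def bracket {r : ℕ} (d : Fin r → ℕ) (X : Module.End ℂ (Fock r)) : ℂ :=
  ∑' c : TracedConf r, formTerm X d c

/-- The linear form `ρ`: as `bracket`, with the bra `⟨θ| = ∑_m ⟨m|` for each diagonal boson. -/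
def rho {r : ℕ} (X : Module.End ℂ (Fock r)) : ℂ := ∑' d : Fin r → ℕ, bracket d X

/-! ### The polynomials -/

/-- The largest part of `lam` (equal to `0` if there are no parts). -/
def largestPart {n : ℕ} (lam : Fin n → ℕ) : ℕ := Finset.univ.sup lam

open Classical in
/-- The distinct rearrangements `μ` of the composition `lam`, i.e. those with `μ⁺ = lam⁺`. -/
def rearrangements {n : ℕ} (lam : Fin n → ℕ) :
    Finset (Fin n → Fin (largestPart lam + 1)) :=
  Finset.univ.filter fun μ => ∃ σ : Equiv.Perm (Fin n), ∀ k, (μ k : ℕ) = lam (σ k)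

/-- The multiplicities `m_1, …, m_r` of the non-zero parts; `mult r lam i` counts the parts equal
to `i + 1`. -/
def mult {n : ℕ} (r : ℕ) (lam : Fin n → ℕ) (i : Fin r) : ℕ :=
  (Finset.univ.filter fun k => lam k = (i : ℕ) + 1).card

/-- The parts `lam'_i = #{k | lam_k ≥ i}` of the conjugate partition, for `i ≥ 1`. -/
def conjPart {n : ℕ} (lam : Fin n → ℕ) (i : ℕ) : ℕ :=
  (Finset.univ.filter fun k => i ≤ lam k).card

/-- The normalisation `Ω = ∏_{1 ≤ i < j ≤ r} (1 - q ^ (j - i) * t ^ (lam'_i - lam'_j))`. -/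
def Omega {n : ℕ} (lam : Fin n → ℕ) (q t : ℂ) : ℂ :=
  ∏ j ∈ Finset.Icc 1 (largestPart lam), ∏ i ∈ Finset.Ico 1 j,
    (1 - q ^ (j - i) * t ^ (conjPart lam i - conjPart lam j))

/-- `f_μ(x; q, t; u, v) = ρ(A_{μ₁}(x₁) ⋯ A_{μₙ}(xₙ) 𝕊)`. -/
def fPoly {n : ℕ} (r : ℕ) (q t u v : ℂ) (μ : Fin n → Fin (r + 1)) (x : Fin n → ℂ) : ℂ :=
  rho (word r q t u v μ x)

/-- `P_lam(x; q, t; u, v)`: the normalised sum of `f_μ` over all rearrangements `μ` of `lam`. -/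
def PPoly {n : ℕ} (lam : Fin n → ℕ) (q t u v : ℂ) (x : Fin n → ℂ) : ℂ :=
  Omega lam q t * ∑ μ ∈ rearrangements lam, fPoly (largestPart lam) q t u v μ x

/-- The Hecke generator
`T f = t f - (t x_i - x_j) / (x_i - x_j) * (f - σ f)` with `σ` the transposition of `x_i` and `x_j`
(used with `j = i + 1`), on functions, evaluated at points with `x_i ≠ x_j`. -/
def heckeT {n : ℕ} (t : ℂ) (i j : Fin n) (f : (Fin n → ℂ) → ℂ) (x : Fin n → ℂ) : ℂ :=
  t * f x - (t * x i - x j) / (x i - x j) * (f x - f (x ∘ Equiv.swap i j))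

/-- Evaluation of a polynomial in `x₁, …, xₙ` with coefficients in `ℂ[q, t, u, v]`. -/
def evalAt {n : ℕ} (N : MvPolynomial (Fin n) (MvPolynomial (Fin 4) ℂ)) (q t u v : ℂ)
    (x : Fin n → ℂ) : ℂ :=
  MvPolynomial.eval x (MvPolynomial.map (MvPolynomial.eval ![q, t, u, v]) N)

/-- A domain of parameters `(q, t)` on which all traces converge. For `‖t‖ ≤ 1` the condition is
`‖q‖ < 1`. -/
def ConvergenceDomain (n : ℕ) (q t : ℂ) : Prop := ‖q‖ < 1 ∧ ‖q‖ * ‖t‖ ^ (2 * n) < 1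

end TBoson

end

open TBoson

/-!
The proof has two independent parts.

*Exchange relations.* On a ket, an entry `L_{ab}(x)` of the `L`-matrix multiplies by a number and
moves one boson from family `b` to family `a`. For `t ≠ 0` this number depends only on the
eigenvalues `t ^ m` of the operators `k`, and quadratic relations between entries of `L(x)` and
`L(y)` become identities between rational functions, one for each relative order of the indices
involved (`genWt₂_gt_gt` and its companions). To compare the kets on both sides, they are embedded
into the space with `ℤ`-valued occupation numbers, where every entry is a shift. The case `t = 0`
follows by continuity of the matrix elements (`LMat_relation`). The resulting relations
`isExchangeMatrix_LMat` say that multiplying by `L` preserves the exchange relations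
`(t x - y) B_i(y) B_j(x) = -(1 - t) y B_i(x) B_j(y) + (x - y) B_j(x) B_i(y)` for `j < i`, together
with `B_i(x) B_i(y) = B_i(y) B_i(x)`, of a vector of commuting operators (`IsExchange.mul_vec`).
They hold for the vector `(1, 0, …, 0)`, hence, by induction over the copies, for the first column
`A_0(x), …, A_r(x)` of the monodromy matrix (`isExchange_opA`). Summation over all indices gives
`[A(x), A(y)] = 0`; applied to two adjacent factors of a word they give the Hecke relations.

*Convergence and rationality.* Every word is a combination, with coefficients polynomial in the
parameters, of normally ordered products `∏ φ†ᵃ k^b φ^c`. No division by `t` is needed, and since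
each `A_i(x)` contributes degree at most two in the `k` and `φ` of every boson, only `b + c ≤ 2 n`
occurs (`opAWord_mem_normSpan`). For such a product the linear form factorises over the bosons. The
traces are sums of geometric series with ratios `q ^ l t ^ j`, `l ≥ 1`, `j ≤ 2 n`, which have norm
less than one on the given domain. This yields absolute convergence and the common denominator
`∏ (1 - q ^ l t ^ j)` (`isRational_opAWord`).

The operator `A_i(x)` raises the total occupation number of family `i` by one and preserves the
others. Hence only the term of the linear form whose `d` consists of the multiplicities of `μ`
contributes to `f_μ` (`formTerm_word_eq_zero`), and these multiplicities characterise the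
rearrangements of `lam` (`mem_rearrangements_iff`). Symmetry of `P_lam` follows from the
commutativity of the operators `A(x)`; averaging over permutations makes the polynomial in the
numerator symmetric.
-/

noncomputable section

namespace TBoson

open Finset

/-! ### Action of the operators on kets -/

section Kets
variable {r : ℕ}

@[simp] lemma opOfKets_ket (F : State r → Fock r) (m : State r) : opOfKets F (ket m) = F m := by
  simp [opOfKets, ket]

lemma end_ext {X Y : Module.End ℂ (Fock r)} (h : ∀ m, X (ket m) = Y (ket m)) : X = Y := by
  refine Finsupp.lhom_ext' fun m => LinearMap.ext_ring ?_
  exact h m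

lemma phi_ket (t : ℂ) (p : Fin r × Fin r) (m : State r) :
    phi t p (ket m) = (1 - t ^ m p) • ket (Function.update m p (m p - 1)) := opOfKets_ket _ _

lemma phiDag_ket (p : Fin r × Fin r) (m : State r) :
    phiDag p (ket m) = ket (Function.update m p (m p + 1)) := opOfKets_ket _ _

lemma kOp_ket (t : ℂ) (p : Fin r × Fin r) (m : State r) :
    kOp t p (ket m) = (t ^ m p) • ket m := opOfKets_ket _ _

lemma kList_ket (t : ℂ) (c : Fin r) (l : List (Fin r)) (m : State r) :
    ((l.map fun i => kOp t (i, c)).prod) (ket m) = (l.map fun i => t ^ m (i, c)).prod • ket m := by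
  induction l with
  | nil => simp
  | cons i l ih => simp [ih, kOp_ket, smul_smul, mul_comm]

lemma list_prod_filter_finRange {M : Type*} [CommMonoid M] (P : Fin r → Prop) [DecidablePred P]
    (f : Fin r → M) :
    (((List.finRange r).filter fun l => P l).map f).prod = ∏ l, if P l then f l else 1 := by
  rw [← List.prod_ofFn, List.ofFn_eq_map]
  induction List.finRange r with
  | nil => rfl
  | cons i l ih => by_cases h : P i <;> simp [h, ih]

/-- The product of the numbers `K l` over the indices `l > a`. -/
def prodAbove (K : Fin (r + 1) → ℂ) (a : Fin (r + 1)) : ℂ := ∏ l, if a < l then K l else 1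

/-- The eigenvalues of the operators `k` of copy `c` on `|m⟩`, with the value `0` for the absent
family `0`. With this convention `1 - kVal 0 = 1`, so index `0` behaves as a family whose
annihilation operator is the identity. -/
def kVal (t : ℂ) (c : Fin r) (m : State r) : Fin (r + 1) → ℂ :=
  Fin.cases 0 fun i => t ^ m (i, c)

lemma kAll_ket (t : ℂ) (c : Fin r) (m : State r) :
    kAll t c (ket m) = prodAbove (kVal t c m) 0 • ket m := by
  rw [kAll, kList_ket, prodAbove, Fin.prod_univ_succ, ← List.ofFn_eq_map, List.prod_ofFn]
  simp [kVal]

lemma kAbove_ket (t : ℂ) (i c : Fin r) (m : State r) :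
    kAbove t i c (ket m) = prodAbove (kVal t c m) i.succ • ket m := by
  rw [kAbove, kList_ket, prodAbove, Fin.prod_univ_succ, list_prod_filter_finRange]
  simp [kVal]

/-- Remove a boson of family `b` from copy `c`; nothing happens for the index `0`. -/
def lower (c : Fin r) (b : Fin (r + 1)) (m : State r) : State r :=
  Fin.cases m (fun j => Function.update m (j, c) (m (j, c) - 1)) b

/-- Add a boson of family `a` to copy `c`; nothing happens for the index `0`. -/
def raise (c : Fin r) (a : Fin (r + 1)) (m : State r) : State r :=
  Fin.cases m (fun j => Function.update m (j, c) (m (j, c) + 1)) a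

/-- The matrix element of `L_{ab}(x)` on `|m⟩`. -/
def natWt (t u v x : ℂ) (c : Fin r) (a b : Fin (r + 1)) (m : State r) : ℂ :=
  if a = 0 then
    if b = 0 then 1 - u * x * prodAbove (kVal t c m) 0
    else (1 - u * v * prodAbove (kVal t c (lower c b m)) 0) * (1 - kVal t c m b)
  else if a = b then prodAbove (kVal t c m) a * (x - v * kVal t c m a)
  else prodAbove (kVal t c (lower c b m)) a * (if b < a then x else v) * (1 - kVal t c m b)

/-- The state to which `L_{ab}` maps `|m⟩`, up to a factor. The diagonal entries preserve `|m⟩`. -/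
def moved (c : Fin r) (a b : Fin (r + 1)) (m : State r) : State r :=
  if a = b then m else raise c a (lower c b m)

lemma prodAbove_update (t : ℂ) (c i : Fin r) (m : State r) (n : ℕ) :
    prodAbove (kVal t c (Function.update m (i, c) n)) i.succ = prodAbove (kVal t c m) i.succ := by
  refine Finset.prod_congr rfl fun l _ => ?_
  refine Fin.cases ?_ (fun l => ?_) l
  · simp
  · by_cases h : i < l
    · simp [kVal, h, h.ne']
    · simp [h]

lemma LMat_ket (t u v x : ℂ) (c : Fin r) (a b : Fin (r + 1)) (m : State r) :
    LMat t u v x c a b (ket m) = natWt t u v x c a b m • ket (moved c a b m) := by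
  refine Fin.cases ?_ (fun i => ?_) a <;> refine Fin.cases ?_ (fun j => ?_) b
  · simp [LMat, natWt, moved, kAll_ket, sub_smul, smul_smul]
  · simp [LMat, natWt, moved, kAll_ket, phi_ket, lower, raise, kVal, smul_smul, sub_smul, sub_mul,
      (Fin.succ_ne_zero j).symm, smul_sub]
    module
  · simp [LMat, natWt, moved, kAbove_ket, phiDag_ket, lower, raise, kVal, smul_smul,
      prodAbove_update]
    congr 1; ring
  · by_cases h : i = j
    · subst h
      simp [LMat, natWt, moved, kAbove_ket, kOp_ket, kVal, smul_smul, sub_smul, mul_sub]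
      module
    · by_cases h' : j < i
      · simp [LMat, natWt, moved, kAbove_ket, phiDag_ket, phi_ket, lower, raise, kVal, smul_smul,
          prodAbove_update, h, h']
        congr 1; ring
      · simp [LMat, natWt, moved, kAbove_ket, phiDag_ket, phi_ket, lower, raise, kVal, smul_smul,
          prodAbove_update, h, h']
        congr 1; ring

lemma continuous_kVal (c : Fin r) (m : State r) (b : Fin (r + 1)) :
    Continuous fun t => kVal t c m b := by
  refine Fin.cases ?_ (fun j => ?_) b <;> simp only [kVal, Fin.cases_zero, Fin.cases_succ] <;>
    fun_prop

lemma continuous_prodAbove (c : Fin r) (m : State r) (a : Fin (r + 1)) :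
    Continuous fun t => prodAbove (kVal t c m) a := by
  refine continuous_finsetProd _ fun l _ => ?_
  split_ifs
  · exact continuous_kVal c m l
  · exact continuous_const

lemma continuous_natWt (u v x : ℂ) (c : Fin r) (a b : Fin (r + 1)) (m : State r) :
    Continuous fun t => natWt t u v x c a b m := by
  have h1 := continuous_prodAbove c m
  have h2 := continuous_prodAbove c (lower c b m)
  have h3 := continuous_kVal c m
  unfold natWt
  split_ifs <;> fun_prop

end Kets

/-! ### Scalar identities behind the exchange relations -/

section Exchange
variable {r : ℕ}

/-- `natWt` in terms of the eigenvalues `K` of the operators `k` alone, for `t ≠ 0`. The factors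
`t⁻¹` are there because in `L_{ab}` with `a < b` the operators `k` act after the annihilation
operator. -/
def genWt (t u v x : ℂ) (K : Fin (r + 1) → ℂ) (a b : Fin (r + 1)) : ℂ :=
  if a = 0 then
    if b = 0 then 1 - u * x * prodAbove K 0
    else (1 - u * v * (prodAbove K 0 * t⁻¹)) * (1 - K b)
  else prodAbove K a *
    if a = b then x - v * K a else if b < a then x * (1 - K b) else v * t⁻¹ * (1 - K b)

/-- The change of `K` under creation of a boson `a` and annihilation of a boson `b`. -/
def shiftK (t : ℂ) (a b : Fin (r + 1)) (K : Fin (r + 1) → ℂ) : Fin (r + 1) → ℂ := fun l =>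
  K l * (if l = a then t else 1) * (if l = b then t⁻¹ else 1)

lemma prodAbove_shiftK (t : ℂ) (a b i : Fin (r + 1)) (K : Fin (r + 1) → ℂ) :
    prodAbove (shiftK t a b K) i =
      prodAbove K i * (if i < a then t else 1) * (if i < b then t⁻¹ else 1) := by
  have key : ∀ (s : ℂ) (e : Fin (r + 1)),
      (∏ l, if i < l then (if l = e then s else 1) else 1) = if i < e then s else 1 := by
    intro s e
    rw [Finset.prod_eq_single e]
    · simp
    · intro l _ hl; simp [hl]
    · simp
  rw [prodAbove, prodAbove, ← key t a, ← key t⁻¹ b, ← Finset.prod_mul_distrib,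
    ← Finset.prod_mul_distrib]
  refine Finset.prod_congr rfl fun l _ => ?_
  by_cases h : i < l <;> simp [h, shiftK]

/-- The coefficient of the operator `L_{ac}(x) L_{bd}(y)`; the right factor acts first. -/
def genWt₂ (t u v x y : ℂ) (K : Fin (r + 1) → ℂ) (a c b d : Fin (r + 1)) : ℂ :=
  genWt t u v y K b d * genWt t u v x (shiftK t b d K) a c

lemma comparison_of_lt {i j : Fin (r + 1)} (h : i < j) : i ≠ j ∧ j ≠ i ∧ ¬ j < i :=
  ⟨h.ne, h.ne', h.not_gt⟩

/-- Trichotomy with all the facts that decide comparisons of `i` and `j`. -/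
lemma comparison (i j : Fin (r + 1)) :
    (i < j ∧ i ≠ j ∧ j ≠ i ∧ ¬ j < i) ∨ i = j ∨ (j < i ∧ i ≠ j ∧ j ≠ i ∧ ¬ i < j) := by
  rcases lt_trichotomy i j with h | h | h
  · exact Or.inl ⟨h, comparison_of_lt h⟩
  · exact Or.inr (Or.inl h)
  · exact Or.inr (Or.inr ⟨h, h.ne', h.ne, h.not_gt⟩)

lemma comparison_zero (i : Fin (r + 1)) : (i = 0 ∧ (i : ℕ) = 0) ∨ (i ≠ 0 ∧ 0 < (i : ℕ)) := by
  rcases eq_or_ne i 0 with h | h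
  · exact Or.inl ⟨h, by simp [h]⟩
  · exact Or.inr ⟨h, Fin.pos_of_ne_zero h⟩

set_option maxHeartbeats 4000000 in
/-- One of the scalar identities between products of two entries of the `L`-matrix. The relation
mixes the rows `a, b` on the left and the columns `c, d` on the right by the same `R`-matrix. The
weights depend only on the relative order of `a, b, c, d` and `0`; once this order is fixed, the
claim is an identity of rational functions in `t`, `K` and the products `prodAbove`. -/
lemma genWt₂_gt_gt {t : ℂ} (ht : t ≠ 0) (u v x y : ℂ) {K : Fin (r + 1) → ℂ} (hK : K 0 = 0)
    {a b c d : Fin (r + 1)} (hba : b < a) (hdc : d < c) :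
    -((1 - t) * y) * genWt₂ t u v x y K a c b d + (x - y) * genWt₂ t u v x y K b c a d =
      -((1 - t) * y) * genWt₂ t u v y x K a c b d + t * (x - y) * genWt₂ t u v y x K a d b c := by
  have ha : a ≠ 0 := Fin.ne_zero_of_lt hba
  have hc : c ≠ 0 := Fin.ne_zero_of_lt hdc
  have hba' := comparison_of_lt hba
  have hdc' := comparison_of_lt hdc
  simp only [genWt₂, genWt, prodAbove_shiftK, ha, if_false]
  rcases comparison_zero b with ⟨hb, hb'⟩ | ⟨hb, hb'⟩ <;>
  rcases comparison_zero d with ⟨hd, hd'⟩ | ⟨hd, hd'⟩ <;>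
  rcases comparison a c with h1 | h1 | h1 <;>
  first
  | omega
  | (rcases comparison b d with h2 | h2 | h2 <;>
     first
     | omega
     | (rcases comparison a d with h3 | h3 | h3 <;>
        first
        | omega
        | (rcases comparison b c with h4 | h4 | h4 <;>
           first
           | omega
           | (subst_vars
              simp only [*, shiftK, lt_irrefl, if_true, if_false, zero_mul]
              try field_simp
              try ring))))

set_option maxHeartbeats 4000000 in
lemma genWt₂_gt_lt {t : ℂ} (ht : t ≠ 0) (u v x y : ℂ) {K : Fin (r + 1) → ℂ} (hK : K 0 = 0)
    {a b c d : Fin (r + 1)} (hba : b < a) (hcd : c < d) :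
    -((1 - t) * y) * genWt₂ t u v x y K a c b d + (x - y) * genWt₂ t u v x y K b c a d =
      -((1 - t) * x) * genWt₂ t u v y x K a c b d + (x - y) * genWt₂ t u v y x K a d b c := by
  have ha : a ≠ 0 := Fin.ne_zero_of_lt hba
  have hd : d ≠ 0 := Fin.ne_zero_of_lt hcd
  have hba' := comparison_of_lt hba
  have hcd' := comparison_of_lt hcd
  simp only [genWt₂, genWt, prodAbove_shiftK, ha, if_false]
  rcases comparison_zero b with ⟨hb, hb'⟩ | ⟨hb, hb'⟩ <;>
  rcases comparison_zero c with ⟨hc, hc'⟩ | ⟨hc, hc'⟩ <;>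
  rcases comparison a d with h1 | h1 | h1 <;>
  first
  | omega
  | (rcases comparison b c with h2 | h2 | h2 <;>
     first
     | omega
     | (rcases comparison a c with h3 | h3 | h3 <;>
        first
        | omega
        | (rcases comparison b d with h4 | h4 | h4 <;>
           first
           | omega
           | (subst_vars
              simp only [*, shiftK, lt_irrefl, if_true, if_false, zero_mul]
              try field_simp
              try ring))))

set_option maxHeartbeats 4000000 in
lemma genWt₂_gt_self {t : ℂ} (ht : t ≠ 0) (u v x y : ℂ) {K : Fin (r + 1) → ℂ} (hK : K 0 = 0)
    {a b : Fin (r + 1)} (hba : b < a) (c : Fin (r + 1)) :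
    -((1 - t) * y) * genWt₂ t u v x y K a c b c + (x - y) * genWt₂ t u v x y K b c a c =
      (t * x - y) * genWt₂ t u v y x K a c b c := by
  have ha : a ≠ 0 := Fin.ne_zero_of_lt hba
  have hba' := comparison_of_lt hba
  simp only [genWt₂, genWt, prodAbove_shiftK, ha, if_false]
  rcases comparison_zero b with ⟨hb, hb'⟩ | ⟨hb, hb'⟩ <;>
  rcases comparison_zero c with ⟨hc, hc'⟩ | ⟨hc, hc'⟩ <;>
  rcases comparison a c with h1 | h1 | h1 <;>
  first
  | omega
  | (rcases comparison b c with h2 | h2 | h2 <;>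
     first
     | omega
     | (subst_vars
        simp only [*, shiftK, lt_irrefl, if_true, if_false, zero_mul]
        try field_simp
        try ring))

set_option maxHeartbeats 4000000 in
lemma genWt₂_self_gt {t : ℂ} (ht : t ≠ 0) (u v x y : ℂ) {K : Fin (r + 1) → ℂ} (hK : K 0 = 0)
    (a : Fin (r + 1)) {c d : Fin (r + 1)} (hdc : d < c) :
    (x - y) * genWt₂ t u v x y K a c a d + (1 - t) * y * genWt₂ t u v x y K a d a c =
      (x - t * y) * genWt₂ t u v y x K a d a c := by
  have hc : c ≠ 0 := Fin.ne_zero_of_lt hdc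
  have hdc' := comparison_of_lt hdc
  simp only [genWt₂, genWt, prodAbove_shiftK]
  rcases comparison_zero a with ⟨ha, ha'⟩ | ⟨ha, ha'⟩ <;>
  rcases comparison_zero d with ⟨hd, hd'⟩ | ⟨hd, hd'⟩ <;>
  rcases comparison a c with h1 | h1 | h1 <;>
  first
  | omega
  | (rcases comparison a d with h2 | h2 | h2 <;>
     first
     | omega
     | (subst_vars
        simp only [*, shiftK, lt_irrefl, if_true, if_false, zero_mul]
        try field_simp
        try ring))

set_option maxHeartbeats 4000000 in
lemma genWt₂_self_self {t : ℂ} (ht : t ≠ 0) (u v x y : ℂ) {K : Fin (r + 1) → ℂ} (hK : K 0 = 0)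
    (a c : Fin (r + 1)) :
    genWt₂ t u v x y K a c a c = genWt₂ t u v y x K a c a c := by
  simp only [genWt₂, genWt, prodAbove_shiftK]
  rcases comparison_zero a with ⟨ha, ha'⟩ | ⟨ha, ha'⟩ <;>
  rcases comparison_zero c with ⟨hc, hc'⟩ | ⟨hc, hc'⟩ <;>
  rcases comparison a c with h1 | h1 | h1 <;>
  first
  | omega
  | (subst_vars
     simp only [*, shiftK, lt_irrefl, if_true, if_false, zero_mul]
     try field_simp
     try ring)

end Exchange

/-! ### Exchange relations in an algebra -/

section Abstract
variable {ι E : Type*} [LinearOrder ι] [Ring E] [Algebra ℂ E]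

/-- The exchange relations satisfied by the operators `A_i(x)`. -/
structure IsExchange (t : ℂ) (B : ℂ → ι → E) : Prop where
  gt : ∀ x y {i j : ι}, j < i → (t * x - y) • (B y i * B x j) =
    -((1 - t) * y) • (B x i * B y j) + (x - y) • (B x j * B y i)
  self : ∀ x y (i : ι), B x i * B y i = B y i * B x i

/-- The exchange relations between the entries of an `L`-matrix that transport exchange relations
from a vector `B` to the vector `L B`. -/
structure IsExchangeMatrix (t : ℂ) (L : ℂ → ι → ι → E) : Prop where
  gt_gt : ∀ x y {a b c d : ι}, b < a → d < c →
    -((1 - t) * y) • (L x a c * L y b d) + (x - y) • (L x b c * L y a d) =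
      -((1 - t) * y) • (L y a c * L x b d) + (t * (x - y)) • (L y a d * L x b c)
  gt_lt : ∀ x y {a b c d : ι}, b < a → c < d →
    -((1 - t) * y) • (L x a c * L y b d) + (x - y) • (L x b c * L y a d) =
      -((1 - t) * x) • (L y a c * L x b d) + (x - y) • (L y a d * L x b c)
  gt_self : ∀ x y {a b : ι} (c : ι), b < a →
    -((1 - t) * y) • (L x a c * L y b c) + (x - y) • (L x b c * L y a c) =
      (t * x - y) • (L y a c * L x b c)
  self_gt : ∀ x y (a : ι) {c d : ι}, d < c →
    (x - y) • (L x a c * L y a d) + ((1 - t) * y) • (L x a d * L y a c) =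
      (x - t * y) • (L y a d * L x a c)
  self_self : ∀ x y (a c : ι), L x a c * L y a c = L y a c * L x a c

/-- The relation `IsExchange.gt` with the roles of the two indices exchanged; it follows by
eliminating `B y j * B x i` between the two relations for `(x, y)` and `(y, x)`. -/
lemma IsExchange.lt {t : ℂ} {B : ℂ → ι → E} (h : IsExchange t B) (x y : ℂ) {i j : ι}
    (hij : i < j) : (t * x - y) • (B y i * B x j) =
      -((1 - t) * x) • (B x i * B y j) + (t * (x - y)) • (B x j * B y i) := by
  rcases eq_or_ne x y with rfl | hxy
  · simp only [sub_self, mul_zero, zero_smul, add_zero]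
    congr 1; ring
  · have h1 := h.gt x y hij
    have h2 := h.gt y x hij
    refine smul_right_injective E (sub_ne_zero.2 hxy) ?_
    simp only
    linear_combination (norm := module) (t * x - y) • h2 - ((1 - t) * x) • h1

/-- If `L` satisfies the relations of an exchange matrix, `B` the exchange relations, and the
entries of `L` commute with those of `B`, then `L B` satisfies the exchange relations. -/
lemma IsExchange.mul_vec [Fintype ι] {t : ℂ} {L : ℂ → ι → ι → E} {B : ℂ → ι → E}
    (hL : IsExchangeMatrix t L) (hB : IsExchange t B)
    (hc : ∀ x y a b c, Commute (L x a b) (B y c)) :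
    IsExchange t fun x a => ∑ b, L x a b * B x b := by
  have expand : ∀ x y a b, (∑ c, L x a c * B x c) * (∑ d, L y b d * B y d) =
      ∑ c, ∑ d, (L x a c * L y b d) * (B x c * B y d) := by
    intro x y a b
    rw [Finset.sum_mul_sum]
    refine Finset.sum_congr rfl fun c _ => Finset.sum_congr rfl fun d _ => ?_
    rw [mul_assoc, ← mul_assoc (B x c), ← (hc y x b d c).eq]
    simp only [mul_assoc]
  constructor
  · intro x y i j hij
    -- the coefficients of the `R`-matrix
    let ρ : ι → ι → ℂ := fun c d =>
      if d < c then -((1 - t) * y) else if c < d then -((1 - t) * x) else t * x - y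
    let σ : ι → ι → ℂ := fun c d =>
      if d < c then t * (x - y) else if c < d then x - y else 0
    have hLL : ∀ c d, -((1 - t) * y) • (L x i c * L y j d) + (x - y) • (L x j c * L y i d) =
        ρ c d • (L y i c * L x j d) + σ c d • (L y i d * L x j c) := by
      intro c d
      rcases lt_trichotomy c d with h | rfl | h
      · simpa [ρ, σ, h, h.not_gt] using hL.gt_lt x y hij h
      · simpa [ρ, σ] using hL.gt_self x y c hij
      · simpa [ρ, σ, h, h.not_gt] using hL.gt_gt x y hij h
    have hBB : ∀ c d, (t * x - y) • (B y c * B x d) =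
        ρ c d • (B x c * B y d) + σ d c • (B x d * B y c) := by
      intro c d
      rcases lt_trichotomy c d with h | rfl | h
      · simpa [ρ, σ, h, h.not_gt] using hB.lt x y h
      · simp [ρ, σ, hB.self y x c]
      · simpa [ρ, σ, h, h.not_gt] using hB.gt x y h
    calc (t * x - y) • ((∑ c, L y i c * B y c) * ∑ d, L x j d * B x d)
        = ∑ c, ∑ d, (L y i c * L x j d) * ((t * x - y) • (B y c * B x d)) := by
          rw [expand]; simp only [Finset.smul_sum, mul_smul_comm]
      _ = ∑ c, ∑ d, (ρ c d • (L y i c * L x j d)) * (B x c * B y d) +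
          ∑ c, ∑ d, (σ d c • (L y i c * L x j d)) * (B x d * B y c) := by
          simp only [hBB, mul_add, mul_smul_comm, smul_mul_assoc, Finset.sum_add_distrib]
      _ = ∑ c, ∑ d, (ρ c d • (L y i c * L x j d) + σ c d • (L y i d * L x j c)) *
            (B x c * B y d) := by
          rw [Finset.sum_comm (f := fun c d => (σ d c • (L y i c * L x j d)) * (B x d * B y c))]
          simp only [add_mul, Finset.sum_add_distrib]
      _ = _ := by
          simp only [← hLL, expand]
          simp only [add_mul, smul_mul_assoc, Finset.sum_add_distrib, Finset.smul_sum]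
  · intro x y a
    rcases eq_or_ne x y with rfl | hxy
    · rfl
    simp only [expand]
    let G : ι → ι → E := fun c d => (L x a c * L y a d) * (B x c * B y d) -
      (L y a c * L x a d) * (B y c * B x d)
    -- `G` is antisymmetric, so its sum vanishes
    have hG : ∀ c d, d < c → G c d + G d c = 0 := by
      intro c d h
      -- the combination eliminates `B x d * B y c` and `B y d * B x c`
      have e1 := congrArg (· * (B x c * B y d)) (hL.self_gt x y a h)
      have e2 := congrArg (· * (B y c * B x d)) (hL.self_gt y x a h)
      have e3 := congrArg ((L x a d * L y a c) * ·) (hB.gt x y h)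
      have e4 := congrArg ((L y a d * L x a c) * ·) (hB.gt y x h)
      simp only [add_mul, mul_add, smul_mul_assoc, mul_smul_comm] at e1 e2 e3 e4
      refine smul_right_injective E (sub_ne_zero.2 hxy) ?_
      simp only [G]
      linear_combination (norm := module) e1 + e2 - e3 - e4
    have hG' : ∀ c d, G c d + G d c = 0 := by
      intro c d
      rcases lt_trichotomy c d with h | rfl | h
      · rw [add_comm]; exact hG d c h
      · simp [G, hL.self_self x y, hB.self x y]
      · exact hG c d h
    have hsum : (2 : ℂ) • ∑ c, ∑ d, G c d = 0 := by
      rw [two_smul]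
      nth_rewrite 2 [Finset.sum_comm]
      rw [← Finset.sum_add_distrib]
      refine Finset.sum_eq_zero fun c _ => ?_
      rw [← Finset.sum_add_distrib]
      exact Finset.sum_eq_zero fun d _ => hG' c d
    have := (smul_eq_zero_iff_right (two_ne_zero (α := ℂ))).1 hsum
    simp only [G, Finset.sum_sub_distrib] at this
    exact sub_eq_zero.1 this

/-- The sum of the two relations for `(x, y)` and `(y, x)` is symmetric in `x` and `y`. -/
lemma IsExchange.commute_sum [Fintype ι] {t : ℂ} {B : ℂ → ι → E} (h : IsExchange t B) (x y : ℂ) :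
    Commute (∑ i, B x i) (∑ i, B y i) := by
  rcases eq_or_ne x y with rfl | hxy
  · exact Commute.refl _
  have key : ∀ i j, j < i → B x i * B y j + B x j * B y i = B y i * B x j + B y j * B x i := by
    intro i j hij
    have h1 := h.gt x y hij
    have h2 := h.gt y x hij
    refine smul_right_injective E (sub_ne_zero.2 hxy) ?_
    simp only
    linear_combination (norm := module) -h1 - h2
  have key' : ∀ i j, B x i * B y j + B x j * B y i = B y i * B x j + B y j * B x i := by
    intro i j
    rcases lt_trichotomy i j with hij | rfl | hij
    · rw [add_comm, key j i hij, add_comm]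
    · rw [h.self x y]
    · exact key i j hij
  have hsum : (2 : ℂ) • ∑ i, ∑ j, B x i * B y j = (2 : ℂ) • ∑ i, ∑ j, B y i * B x j := by
    rw [two_smul, two_smul]
    nth_rewrite 2 [Finset.sum_comm]
    nth_rewrite 4 [Finset.sum_comm]
    simp only [← Finset.sum_add_distrib, key']
  rw [commute_iff_eq, Finset.sum_mul_sum, Finset.sum_mul_sum]
  exact smul_right_injective E two_ne_zero hsum

end Abstract

/-! ### Exchange relations of the `L`-matrix -/

section RLL
variable {r : ℕ}

/-- The kets as elements of the free vector space on `ℤ`-valued occupation numbers. There the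
operators `L_{ab}` always shift the occupation numbers by the same vector, whether or not bosons
are left to annihilate. -/
def embed : Fock r →ₗ[ℂ] ((Fin r × Fin r → ℤ) →₀ ℂ) :=
  Finsupp.lmapDomain ℂ ℂ fun (m : State r) p => (m p : ℤ)

lemma embed_injective : Function.Injective (embed (r := r)) := by
  refine Finsupp.mapDomain_injective fun m m' h => funext fun p => ?_
  exact_mod_cast congrFun h p

lemma embed_ket (m : State r) : embed (ket m) = Finsupp.single (fun p => (m p : ℤ)) 1 := by
  simp [embed, ket, Finsupp.mapDomain_single]

/-- The occupation numbers of a single boson of family `a` in copy `c`, and `0` for `a = 0`. -/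
def unitOcc (c : Fin r) (a : Fin (r + 1)) : Fin r × Fin r → ℤ :=
  Fin.cases 0 (fun i => Pi.single (i, c) 1) a

lemma raise_coe (c : Fin r) (a : Fin (r + 1)) (m : State r) :
    (fun p => (raise c a m p : ℤ)) = (fun p => (m p : ℤ)) + unitOcc c a := by
  refine Fin.cases ?_ (fun i => ?_) a
  · simp [raise, unitOcc]
  · funext p
    rcases eq_or_ne p (i, c) with rfl | h
    · simp [raise, unitOcc]
    · simp [raise, unitOcc, h]

lemma lower_coe (t : ℂ) (c : Fin r) (b : Fin (r + 1)) (m : State r) (hb : 1 - kVal t c m b ≠ 0) :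
    (fun p => (lower c b m p : ℤ)) = (fun p => (m p : ℤ)) - unitOcc c b := by
  revert hb
  refine Fin.cases ?_ (fun i => ?_) b
  · simp [lower, unitOcc]
  · intro hb
    have hm : 1 ≤ m (i, c) := by
      by_contra h
      have : m (i, c) = 0 := by omega
      simp [kVal, this] at hb
    funext p
    rcases eq_or_ne p (i, c) with rfl | h
    · simp [lower, unitOcc, hm]
    · simp [lower, unitOcc, h]

/-- Truncated subtraction does no harm: where it truncates, the weight vanishes. -/
lemma moved_coe (t u v x : ℂ) (c : Fin r) (a b : Fin (r + 1)) (m : State r)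
    (h : natWt t u v x c a b m ≠ 0) :
    (fun p => (moved c a b m p : ℤ)) = (fun p => (m p : ℤ)) + unitOcc c a - unitOcc c b := by
  rcases eq_or_ne a b with rfl | hab
  · simp [moved]
  · have hb : 1 - kVal t c m b ≠ 0 := by
      intro h0
      rcases eq_or_ne b 0 with rfl | hb0
      · simp [kVal] at h0
      · apply h
        simp [natWt, h0, hb0, hab]
    rw [moved, if_neg hab, raise_coe, lower_coe t c b m hb]
    abel

/-- The eigenvalues `k` depend on the occupation numbers through powers of `t`. -/
lemma kVal_moved {t : ℂ} (ht : t ≠ 0) (u v x : ℂ) (c : Fin r) (a b : Fin (r + 1)) (m : State r)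
    (h : natWt t u v x c a b m ≠ 0) :
    kVal t c (moved c a b m) = shiftK t a b (kVal t c m) := by
  have h1 := moved_coe t u v x c a b m h
  funext l
  refine Fin.cases ?_ (fun i => ?_) l
  · simp [kVal, shiftK]
  · have h2 := congrFun h1 (i, c)
    have h3 : ∀ e : Fin (r + 1), unitOcc c e (i, c) = if i.succ = e then 1 else 0 := by
      intro e
      refine Fin.cases ?_ (fun j => ?_) e
      · simp [unitOcc]
      · simp [unitOcc, Pi.single_apply]
    simp only [Pi.add_apply, Pi.sub_apply, h3] at h2
    simp only [kVal, Fin.cases_succ, shiftK]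
    rw [← zpow_natCast, h2, zpow_sub₀ ht, zpow_add₀ ht, zpow_natCast]
    split_ifs <;> simp [div_eq_mul_inv]

lemma prodAbove_lower {t : ℂ} (ht : t ≠ 0) (c : Fin r) (a b : Fin (r + 1)) (m : State r) :
    prodAbove (kVal t c (lower c b m)) a * (1 - kVal t c m b) =
      prodAbove (kVal t c m) a * (if a < b then t⁻¹ else 1) * (1 - kVal t c m b) := by
  refine Fin.cases ?_ (fun i => ?_) b
  · simp [lower]
  · rcases Nat.eq_zero_or_pos (m (i, c)) with h0 | h0
    · simp [kVal, h0]
    · congr 1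
      have key : (if a < i.succ then t⁻¹ else 1) =
          ∏ l, if a < l then (if l = i.succ then t⁻¹ else 1) else 1 := by
        rw [Finset.prod_eq_single i.succ]
        · simp
        · intro l _ hl; simp [hl]
        · simp
      rw [prodAbove, prodAbove, key, ← Finset.prod_mul_distrib]
      refine Finset.prod_congr rfl fun l _ => ?_
      refine Fin.cases ?_ (fun j => ?_) l
      · simp
      · by_cases hl : a < j.succ
        · rcases eq_or_ne j i with rfl | hji
          · simp only [hl, if_true, kVal, Fin.cases_succ, lower, Function.update_self]
            rw [pow_sub₀ t ht h0, pow_one]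
          · simp [hl, kVal, lower, hji]
        · simp [hl]

/-- For `t ≠ 0` annihilating a boson divides the eigenvalue of `k` by `t`, so the weights become
functions of the eigenvalues before annihilation. -/
lemma natWt_eq_genWt {t : ℂ} (ht : t ≠ 0) (u v x : ℂ) (c : Fin r) (a b : Fin (r + 1))
    (m : State r) : natWt t u v x c a b m = genWt t u v x (kVal t c m) a b := by
  have key := prodAbove_lower ht c a b m
  unfold natWt genWt
  split_ifs with h1 h2 h3 h4
  · rfl
  · subst h1
    rw [if_pos (Fin.pos_of_ne_zero h2)] at key
    linear_combination (-u * v) * key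
  · rfl
  · rw [if_neg h4.not_gt] at key
    linear_combination x * key
  · rw [if_pos (lt_of_le_of_ne (not_lt.1 h4) h3)] at key
    linear_combination v * key

lemma embed_LMat_mul {t : ℂ} (ht : t ≠ 0) (u v x y : ℂ) (e a c b d) (m : State r) :
    embed ((LMat t u v x e a c * LMat t u v y e b d) (ket m)) =
      genWt₂ t u v x y (kVal t e m) a c b d •
        Finsupp.single ((fun p => (m p : ℤ)) +
          (unitOcc e a + unitOcc e b - unitOcc e c - unitOcc e d)) 1 := by
  rw [Module.End.mul_apply, LMat_ket, map_smul, LMat_ket, smul_smul, map_smul, genWt₂,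
    ← natWt_eq_genWt ht]
  by_cases h1 : natWt t u v y e b d m = 0
  · simp [h1]
  · rw [← kVal_moved ht u v y e b d m h1, ← natWt_eq_genWt ht]
    by_cases h2 : natWt t u v x e a c (moved e b d m) = 0
    · simp [h2]
    · rw [embed_ket, moved_coe t u v x e a c _ h2, moved_coe t u v y e b d _ h1]
      congr 2; abel

/-- Linear relations between the products `L_{ac}(x) L_{bd}(y)` that shift occupation numbers by
the same vector follow from the corresponding relations between the coefficients at generic `t`;
the value `t = 0`, where negative powers of `t` make no sense, is reached by continuity. -/
lemma LMat_relation {ι : Type*} [Fintype ι] (u v : ℂ) (e : Fin r) (α : ι → ℂ → ℂ)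
    (hα : ∀ i, Continuous (α i)) (X Y : ι → ℂ) (A B C D : ι → Fin (r + 1))
    (hshift : ∀ i j, unitOcc e (A i) + unitOcc e (B i) - unitOcc e (C i) - unitOcc e (D i) =
      unitOcc e (A j) + unitOcc e (B j) - unitOcc e (C j) - unitOcc e (D j))
    (H : ∀ t ≠ 0, ∀ K : Fin (r + 1) → ℂ, K 0 = 0 →
      ∑ i, α i t * genWt₂ t u v (X i) (Y i) K (A i) (C i) (B i) (D i) = 0) (t : ℂ) :
    ∑ i, α i t • (LMat t u v (X i) e (A i) (C i) * LMat t u v (Y i) e (B i) (D i)) = 0 := by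
  have generic : ∀ t ≠ 0, ∑ i, α i t •
      (LMat t u v (X i) e (A i) (C i) * LMat t u v (Y i) e (B i) (D i)) = 0 := by
    intro t ht
    refine end_ext fun m => embed_injective ?_
    rcases isEmpty_or_nonempty ι with h | ⟨⟨i₀⟩⟩
    · simp
    simp only [LinearMap.sum_apply, LinearMap.smul_apply, map_sum, map_smul, embed_LMat_mul ht,
      fun i => hshift i i₀, smul_smul, ← Finset.sum_smul, LinearMap.zero_apply, map_zero]
    rw [H t ht _ rfl, zero_smul]
  refine end_ext fun m => Finsupp.ext fun p => ?_
  simp only [LinearMap.sum_apply, LinearMap.smul_apply, Module.End.mul_apply, LMat_ket, map_smul,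
    smul_smul, Finsupp.finsetSum_apply, Finsupp.smul_apply, LinearMap.zero_apply,
    Finsupp.zero_apply]
  have hcont : Continuous fun t => ∑ i, (α i t * (natWt t u v (Y i) e (B i) (D i) m *
      natWt t u v (X i) e (A i) (C i) (moved e (B i) (D i) m))) •
      (ket (moved e (A i) (C i) (moved e (B i) (D i) m)) : Fock r) p := by
    have h1 := fun i m => continuous_natWt u v (Y i) e (B i) (D i) m
    have h2 := fun i m => continuous_natWt u v (X i) e (A i) (C i) m
    fun_prop
  refine congrFun (Continuous.ext_on (dense_compl_singleton (0 : ℂ)) hcont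
    (continuous_const (y := (0 : ℂ))) fun t ht => ?_) t
  have := DFunLike.congr_fun (LinearMap.congr_fun (generic t ht) (ket m)) p
  simpa only [LinearMap.sum_apply, LinearMap.smul_apply, Module.End.mul_apply, LMat_ket, map_smul,
    smul_smul, Finsupp.finsetSum_apply, Finsupp.smul_apply, LinearMap.zero_apply,
    Finsupp.zero_apply] using this

/-- The `RLL` relation for the `L`-matrix of a single copy. -/
lemma isExchangeMatrix_LMat (t u v : ℂ) (e : Fin r) :
    IsExchangeMatrix t fun x => LMat t u v x e := by
  constructor
  -- the terms of each relation are listed by their coefficients, arguments and matrix indices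
  · intro x y a b c d hba hdc
    have := LMat_relation (ι := Fin 4) u v e
      ![fun t => -((1 - t) * y), fun _ => x - y, fun t => (1 - t) * y, fun t => -(t * (x - y))]
      (by intro i; fin_cases i <;> simp <;> fun_prop)
      ![x, x, y, y] ![y, y, x, x] ![a, b, a, a] ![b, a, b, b] ![c, c, c, d] ![d, d, d, c]
      (by intro i j; fin_cases i <;> fin_cases j <;> simp <;> abel)
      (by
        intro t ht K hK
        simp only [Fin.sum_univ_four, Matrix.cons_val]
        linear_combination genWt₂_gt_gt ht u v x y hK hba hdc) t
    simp only [Fin.sum_univ_four, Matrix.cons_val] at this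
    refine sub_eq_zero.1 (Eq.trans ?_ this)
    module
  · intro x y a b c d hba hcd
    have := LMat_relation (ι := Fin 4) u v e
      ![fun t => -((1 - t) * y), fun _ => x - y, fun t => (1 - t) * x, fun _ => -(x - y)]
      (by intro i; fin_cases i <;> simp <;> fun_prop)
      ![x, x, y, y] ![y, y, x, x] ![a, b, a, a] ![b, a, b, b] ![c, c, c, d] ![d, d, d, c]
      (by intro i j; fin_cases i <;> fin_cases j <;> simp <;> abel)
      (by
        intro t ht K hK
        simp only [Fin.sum_univ_four, Matrix.cons_val]
        linear_combination genWt₂_gt_lt ht u v x y hK hba hcd) t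
    simp only [Fin.sum_univ_four, Matrix.cons_val] at this
    refine sub_eq_zero.1 (Eq.trans ?_ this)
    module
  · intro x y a b c hba
    have := LMat_relation (ι := Fin 3) u v e
      ![fun t => -((1 - t) * y), fun _ => x - y, fun t => -(t * x - y)]
      (by intro i; fin_cases i <;> simp <;> fun_prop)
      ![x, x, y] ![y, y, x] ![a, b, a] ![b, a, b] ![c, c, c] ![c, c, c]
      (by intro i j; fin_cases i <;> fin_cases j <;> simp <;> abel)
      (by
        intro t ht K hK
        simp only [Fin.sum_univ_three, Matrix.cons_val]
        linear_combination genWt₂_gt_self ht u v x y hK hba c) t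
    simp only [Fin.sum_univ_three, Matrix.cons_val] at this
    refine sub_eq_zero.1 (Eq.trans ?_ this)
    module
  · intro x y a c d hdc
    have := LMat_relation (ι := Fin 3) u v e
      ![fun _ => x - y, fun t => (1 - t) * y, fun t => -(x - t * y)]
      (by intro i; fin_cases i <;> simp <;> fun_prop)
      ![x, x, y] ![y, y, x] ![a, a, a] ![a, a, a] ![c, d, d] ![d, c, c]
      (by intro i j; fin_cases i <;> fin_cases j <;> simp <;> abel)
      (by
        intro t ht K hK
        simp only [Fin.sum_univ_three, Matrix.cons_val]
        linear_combination genWt₂_self_gt ht u v x y hK a hdc) t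
    simp only [Fin.sum_univ_three, Matrix.cons_val] at this
    refine sub_eq_zero.1 (Eq.trans ?_ this)
    module
  · intro x y a c
    have := LMat_relation (ι := Fin 2) u v e ![fun _ => 1, fun _ => -1]
      (by intro i; fin_cases i <;> simp <;> fun_prop)
      ![x, y] ![y, x] ![a, a] ![a, a] ![c, c] ![c, c]
      (by intro i j; fin_cases i <;> fin_cases j <;> simp)
      (by
        intro t ht K hK
        simp only [Fin.sum_univ_two, Matrix.cons_val]
        linear_combination genWt₂_self_self ht u v x y hK a c) t
    simp only [Fin.sum_univ_two, Matrix.cons_val] at this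
    refine sub_eq_zero.1 (Eq.trans ?_ this)
    module

end RLL

/-! ### The first column of the monodromy matrix -/

section Copies
variable {r : ℕ}

lemma raise_apply_of_ne {c e : Fin r} (h : e ≠ c) (a : Fin (r + 1)) (m : State r) (i : Fin r) :
    raise e a m (i, c) = m (i, c) := by
  refine Fin.cases ?_ (fun j => ?_) a
  · rfl
  · simp [raise, h.symm]

lemma lower_apply_of_ne {c e : Fin r} (h : e ≠ c) (a : Fin (r + 1)) (m : State r) (i : Fin r) :
    lower e a m (i, c) = m (i, c) := by
  refine Fin.cases ?_ (fun j => ?_) a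
  · rfl
  · simp [lower, h.symm]

lemma moved_apply_of_ne {c e : Fin r} (h : e ≠ c) (a b : Fin (r + 1)) (m : State r) (i : Fin r) :
    moved e a b m (i, c) = m (i, c) := by
  unfold moved
  split_ifs
  · rfl
  · rw [raise_apply_of_ne h, lower_apply_of_ne h]

lemma lower_congr {c : Fin r} {m m' : State r} (h : ∀ i, m (i, c) = m' (i, c))
    (b : Fin (r + 1)) (i : Fin r) : lower c b m (i, c) = lower c b m' (i, c) := by
  refine Fin.cases ?_ (fun j => ?_) b
  · exact h i
  · rcases eq_or_ne i j with rfl | hij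
    · simp [lower, h]
    · simp [lower, hij, h]

lemma raise_congr {c : Fin r} {m m' : State r} (h : ∀ i, m (i, c) = m' (i, c))
    (b : Fin (r + 1)) (i : Fin r) : raise c b m (i, c) = raise c b m' (i, c) := by
  refine Fin.cases ?_ (fun j => ?_) b
  · exact h i
  · rcases eq_or_ne i j with rfl | hij
    · simp [raise, h]
    · simp [raise, hij, h]

lemma moved_congr {c : Fin r} {m m' : State r} (h : ∀ i, m (i, c) = m' (i, c))
    (a b : Fin (r + 1)) (i : Fin r) : moved c a b m (i, c) = moved c a b m' (i, c) := by
  unfold moved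
  split_ifs
  · exact h i
  · exact raise_congr (lower_congr h b) a i

lemma kVal_congr (t : ℂ) {c : Fin r} {m m' : State r} (h : ∀ i, m (i, c) = m' (i, c)) :
    kVal t c m = kVal t c m' := by
  funext l
  refine Fin.cases ?_ (fun i => ?_) l
  · rfl
  · simp [kVal, h]

lemma natWt_congr (t u v x : ℂ) {c : Fin r} {m m' : State r} (h : ∀ i, m (i, c) = m' (i, c))
    (a b : Fin (r + 1)) : natWt t u v x c a b m = natWt t u v x c a b m' := by
  simp only [natWt, kVal_congr t h, kVal_congr t (lower_congr h b)]

lemma moved_comm {c e : Fin r} (h : c ≠ e) (a b a' b' : Fin (r + 1)) (m : State r) :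
    moved c a b (moved e a' b' m) = moved e a' b' (moved c a b m) := by
  funext ⟨i, j⟩
  by_cases hc : c = j
  · subst hc
    rw [moved_apply_of_ne h.symm]
    exact moved_congr (moved_apply_of_ne h.symm a' b' m) a b i
  · rw [moved_apply_of_ne hc]
    by_cases he : e = j
    · subst he
      exact (moved_congr (moved_apply_of_ne h a b m) a' b' i).symm
    · rw [moved_apply_of_ne he, moved_apply_of_ne he, moved_apply_of_ne hc]

lemma commute_LMat (t u v x y : ℂ) {c e : Fin r} (h : c ≠ e) (a b a' b' : Fin (r + 1)) :
    Commute (LMat t u v x c a b) (LMat t u v y e a' b') := by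
  refine end_ext fun m => ?_
  simp only [Module.End.mul_apply, LMat_ket, map_smul, smul_smul]
  rw [moved_comm h, natWt_congr t u v x (moved_apply_of_ne h.symm a' b' m),
    natWt_congr t u v y (moved_apply_of_ne h a b m), mul_comm]

/-- The product of the `L`-matrices of the copies in a list. -/
def partialMonodromy (t u v x : ℂ) (cs : List (Fin r)) :
    Matrix (Fin (r + 1)) (Fin (r + 1)) (Module.End ℂ (Fock r)) :=
  (cs.map fun c => LMat t u v x c).prod

lemma partialMonodromy_cons (t u v x : ℂ) (c : Fin r) (cs : List (Fin r)) (a b : Fin (r + 1)) :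
    partialMonodromy t u v x (c :: cs) a b =
      ∑ d, LMat t u v x c a d * partialMonodromy t u v x cs d b := by
  simp [partialMonodromy, Matrix.mul_apply]

lemma commute_partialMonodromy (t u v x y : ℂ) {c : Fin r} {cs : List (Fin r)} (h : c ∉ cs)
    (a b a' b' : Fin (r + 1)) :
    Commute (LMat t u v x c a b) (partialMonodromy t u v y cs a' b') := by
  induction cs generalizing a' with
  | nil =>
    simp only [partialMonodromy, List.map_nil, List.prod_nil, Matrix.one_apply]
    split_ifs
    · exact Commute.one_right _
    · exact Commute.zero_right _
  | cons e cs ih =>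
    rw [partialMonodromy_cons]
    refine Commute.sum_right _ _ _ fun d _ => Commute.mul_right ?_ (ih ?_ d)
    · exact commute_LMat t u v x y (fun he => h (by simp [he])) _ _ _ _
    · exact fun hc => h (List.mem_cons_of_mem _ hc)

/-- The first column of a monodromy matrix satisfies the exchange relations: this holds for the
empty product, and multiplication by a further `L`-matrix preserves it. -/
lemma isExchange_partialMonodromy (t u v : ℂ) {cs : List (Fin r)} (h : cs.Nodup) :
    IsExchange t fun x a => partialMonodromy t u v x cs a 0 := by
  induction cs with
  | nil =>
    constructor
    · intro x y i j hij
      simp [partialMonodromy, Matrix.one_apply, Fin.ne_zero_of_lt hij]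
    · intro x y i
      simp [partialMonodromy, Matrix.one_apply]
  | cons c cs ih =>
    simp only [partialMonodromy_cons]
    exact IsExchange.mul_vec (isExchangeMatrix_LMat t u v c) (ih h.of_cons)
      fun x y a b d => commute_partialMonodromy t u v x y (List.nodup_cons.1 h).1 a b d 0

lemma isExchange_opA (t u v : ℂ) : IsExchange t fun x i => opA r t u v i x :=
  isExchange_partialMonodromy t u v (List.nodup_finRange r)

lemma commute_opASum (t u v x y : ℂ) : Commute (opASum r t u v x) (opASum r t u v y) :=
  (isExchange_opA t u v).commute_sum x y

end Copies

/-! ### Conservation of occupation numbers and the twist -/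

section Charge
variable {r : ℕ}

/-- The total occupation number of a family, over all copies. -/
def total (m : State r) (i : Fin r) : ℕ := ∑ j, m (i, j)

/-- The operator `X` changes the total occupation numbers of all families by `α - β`. -/
def HasCharge (X : Module.End ℂ (Fock r)) (α β : Fin r → ℕ) : Prop :=
  ∀ m p, X (ket m) p ≠ 0 → total p + β = total m + α

lemma ket_apply_ne {m p : State r} {a : ℂ} (h : (a • ket m) p ≠ 0) : a ≠ 0 ∧ p = m := by
  by_contra hc
  apply h
  by_cases ha : a = 0
  · simp [ha]
  · have hp : p ≠ m := fun hp => hc ⟨ha, hp⟩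
    simp [ket, hp.symm]

lemma end_apply_eq_sum (X : Module.End ℂ (Fock r)) (f : Fock r) (p : State r) :
    X f p = ∑ n ∈ f.support, f n * X (ket n) p := by
  conv_lhs => rw [← Finsupp.sum_single f, Finsupp.sum, map_sum]
  rw [Finsupp.finsetSum_apply]
  refine Finset.sum_congr rfl fun n _ => ?_
  rw [← mul_one (f n), ← smul_eq_mul (f n), ← Finsupp.smul_single, map_smul]
  simp [ket]

lemma HasCharge.mul {X Y : Module.End ℂ (Fock r)} {α β α' β' : Fin r → ℕ}
    (hX : HasCharge X α β) (hY : HasCharge Y α' β') : HasCharge (X * Y) (α + α') (β + β') := by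
  intro m p h
  rw [Module.End.mul_apply, end_apply_eq_sum] at h
  obtain ⟨n, -, hn⟩ := Finset.exists_ne_zero_of_sum_ne_zero h
  have h1 := hX n p (right_ne_zero_of_mul hn)
  have h2 := hY m n (left_ne_zero_of_mul hn)
  funext i
  have h1 := congrFun h1 i
  have h2 := congrFun h2 i
  simp only [Pi.add_apply] at h1 h2 ⊢
  omega

lemma HasCharge.sum {ι : Type*} {s : Finset ι} {X : ι → Module.End ℂ (Fock r)}
    {α β : Fin r → ℕ} (h : ∀ i ∈ s, HasCharge (X i) α β) : HasCharge (∑ i ∈ s, X i) α β := by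
  intro m p hp
  rw [LinearMap.sum_apply, Finsupp.finsetSum_apply] at hp
  obtain ⟨n, hn, hn'⟩ := Finset.exists_ne_zero_of_sum_ne_zero hp
  exact h n hn m p hn'

lemma HasCharge.of_add {X : Module.End ℂ (Fock r)} {α β γ : Fin r → ℕ}
    (h : HasCharge X (α + γ) (γ + β)) : HasCharge X α β := by
  intro m p hp
  have := h m p hp
  funext i
  have := congrFun this i
  simp only [Pi.add_apply] at this ⊢
  omega

lemma hasCharge_one : HasCharge (1 : Module.End ℂ (Fock r)) 0 0 := by
  intro m p h
  rw [Module.End.one_apply, ← one_smul ℂ (ket m)] at h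
  rw [(ket_apply_ne h).2]

/-- The charge of the index `a`: one boson of family `a`, none for `a = 0`. -/
def unitCharge (a : Fin (r + 1)) : Fin r → ℕ := fun i => if a = i.succ then 1 else 0

lemma hasCharge_LMat (t u v x : ℂ) (c : Fin r) (a b : Fin (r + 1)) :
    HasCharge (LMat t u v x c a b) (unitCharge a) (unitCharge b) := by
  intro m p h
  rw [LMat_ket] at h
  obtain ⟨h1, rfl⟩ := ket_apply_ne h
  have h2 := moved_coe t u v x c a b m h1
  have h3 : ∀ (e : Fin (r + 1)) (i : Fin r), ∑ j, unitOcc c e (i, j) = (unitCharge e i : ℤ) := by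
    intro e i
    refine Fin.cases ?_ (fun l => ?_) e
    · simp [unitOcc, unitCharge, (Fin.succ_ne_zero i).symm]
    · simp [unitOcc, unitCharge, Pi.single_apply, ite_and, eq_comm]
  funext i
  have h4 : (total (moved c a b m) i : ℤ) = total m i + unitCharge a i - unitCharge b i := by
    rw [← h3 a, ← h3 b, total, total]
    push_cast
    rw [← Finset.sum_add_distrib, ← Finset.sum_sub_distrib]
    exact Finset.sum_congr rfl fun j _ => congrFun h2 (i, j)
  simp only [Pi.add_apply]
  omega

lemma hasCharge_partialMonodromy (t u v x : ℂ) (cs : List (Fin r)) (a b : Fin (r + 1)) :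
    HasCharge (partialMonodromy t u v x cs a b) (unitCharge a) (unitCharge b) := by
  induction cs generalizing a with
  | nil =>
    rcases eq_or_ne a b with rfl | h
    · simp only [partialMonodromy, List.map_nil, List.prod_nil, Matrix.one_apply_eq]
      refine HasCharge.of_add (γ := 0) ?_
      have := hasCharge_one (r := r)
      intro m p hp
      have := this m p hp
      simp only [add_zero, zero_add] at this ⊢
      rw [this]
    · intro m p hp
      simp [partialMonodromy, Matrix.one_apply_ne h] at hp
  | cons c cs ih =>
    rw [partialMonodromy_cons]
    exact HasCharge.sum fun d _ => HasCharge.of_add (γ := unitCharge d)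
      ((hasCharge_LMat t u v x c a d).mul (ih d))

lemma hasCharge_opA (t u v x : ℂ) (a : Fin (r + 1)) :
    HasCharge (opA r t u v a x) (unitCharge a) 0 := by
  have h0 : unitCharge (0 : Fin (r + 1)) = 0 :=
    funext fun i => if_neg (Fin.succ_ne_zero i).symm
  rw [← h0]
  exact hasCharge_partialMonodromy t u v x (List.finRange r) a 0

/-- `A_{μ₁}(x₁) ⋯ A_{μₙ}(xₙ)`, without the twist. -/
def opAWord {n : ℕ} (r : ℕ) (t u v : ℂ) (μ : Fin n → Fin (r + 1)) (x : Fin n → ℂ) :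
    Module.End ℂ (Fock r) :=
  (List.ofFn fun k => opA r t u v (μ k) (x k)).prod

lemma hasCharge_opAWord {n : ℕ} (t u v : ℂ) (μ : Fin n → Fin (r + 1)) (x : Fin n → ℂ) :
    HasCharge (opAWord r t u v μ x) (∑ k, unitCharge (μ k)) 0 := by
  induction n with
  | zero => simpa [opAWord] using hasCharge_one
  | succ n ih =>
    rw [opAWord, List.ofFn_succ, List.prod_cons, Fin.sum_univ_succ]
    exact (hasCharge_opA t u v (x 0) (μ 0)).mul (ih (fun k => μ k.succ) fun k => x k.succ)

/-- The weight of the twist on `|m⟩`. -/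
def twistWt (q : ℂ) (m : State r) : ℂ :=
  ∏ p : Fin r × Fin r, if p.2 < p.1 then (q ^ ((p.1 : ℕ) - (p.2 : ℕ))) ^ m p else 1

lemma twist_ket (q : ℂ) (m : State r) : twist r q (ket m) = twistWt q m • ket m := by
  have eig : ∀ {ι : Type} (l : List ι) (X : ι → Module.End ℂ (Fock r)) (w : ι → ℂ),
      (∀ i, X i (ket m) = w i • ket m) →
      (l.map X).prod (ket m) = (l.map w).prod • ket m := by
    intro ι l X w h
    induction l with
    | nil => simp
    | cons i l ih => simp [ih, h, smul_smul, mul_comm]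
  have hpow : ∀ (p : Fin r × Fin r) (e : ℕ),
      (kOp q p ^ e) (ket m) = (q ^ e) ^ m p • ket m := by
    intro p e
    induction e with
    | zero => simp
    | succ e ih => rw [pow_succ', Module.End.mul_apply, ih, map_smul, kOp_ket, smul_smul,
        pow_succ, mul_pow]
  rw [twist, eig _ _
    (fun j => ∏ l : Fin r, if j < l then (q ^ ((l : ℕ) - (j : ℕ))) ^ m (l, j) else 1),
    ← List.ofFn_eq_map, List.prod_ofFn, twistWt, Fintype.prod_prod_type_right]
  intro j
  rw [twistCopy, eig _ _ fun l : Fin r => (q ^ ((l : ℕ) - (j : ℕ))) ^ m (l, j)]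
  · rw [list_prod_filter_finRange]
  · exact fun l => hpow (l, j) _

lemma formTerm_mul_twist (X : Module.End ℂ (Fock r)) (q : ℂ) (d : Fin r → ℕ)
    (c : TracedConf r) :
    formTerm (X * twist r q) d c = twistWt q (stateOf 0 c) * formTerm X d c := by
  simp [formTerm, matrixElement, twist_ket]

lemma total_stateOf (d : Fin r → ℕ) (c : TracedConf r) :
    total (stateOf d c) = total (stateOf 0 c) + d := by
  funext i
  have : ∀ j, stateOf d c (i, j) = stateOf 0 c (i, j) + if i = j then d i else 0 := by
    intro j
    by_cases h : j < i
    · simp [stateOf, h, h.ne']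
    · by_cases h' : i = j <;> simp [stateOf, h, h']
  simp [total, this, Finset.sum_add_distrib]

/-- Conservation of occupation numbers: only one summand `⟨d|` of the bra pairs non-trivially
with a given word. -/
lemma formTerm_word_eq_zero {n : ℕ} (q t u v : ℂ) (μ : Fin n → Fin (r + 1)) (x : Fin n → ℂ)
    {d : Fin r → ℕ} (hd : d ≠ ∑ k, unitCharge (μ k)) (c : TracedConf r) :
    formTerm (word r q t u v μ x) d c = 0 := by
  change formTerm (opAWord r t u v μ x * twist r q) d c = 0
  rw [formTerm_mul_twist]
  by_contra h
  have h1 := hasCharge_opAWord t u v μ x _ _ (right_ne_zero_of_mul h)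
  rw [total_stateOf, add_zero] at h1
  exact hd (add_left_cancel h1)

end Charge

/-! ### Polynomial functions of the parameters -/

section Params

/-- The parameters `q, t, u, v` and the variables `x₁, …, xₙ`. -/
structure Params (n : ℕ) where
  q : ℂ
  t : ℂ
  u : ℂ
  v : ℂ
  x : Fin n → ℂ

/-- The value of a polynomial in all the parameters. -/
def evalParams {n : ℕ} (p : Params n) : MvPolynomial (Fin n) (MvPolynomial (Fin 4) ℂ) →+* ℂ :=
  (MvPolynomial.eval p.x).comp (MvPolynomial.map (MvPolynomial.eval ![p.q, p.t, p.u, p.v]))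

lemma evalAt_eq {n : ℕ} (N : MvPolynomial (Fin n) (MvPolynomial (Fin 4) ℂ)) (p : Params n) :
    evalAt N p.q p.t p.u p.v p.x = evalParams p N := rfl

/-- Functions of the parameters that are polynomial. -/
def IsPolyFun {n : ℕ} (f : Params n → ℂ) : Prop :=
  ∃ N : MvPolynomial (Fin n) (MvPolynomial (Fin 4) ℂ), ∀ p, f p = evalParams p N

variable {n : ℕ} {f g : Params n → ℂ}

lemma IsPolyFun.add (hf : IsPolyFun f) (hg : IsPolyFun g) : IsPolyFun fun p => f p + g p := by
  obtain ⟨N, hN⟩ := hf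
  obtain ⟨M, hM⟩ := hg
  exact ⟨N + M, fun p => by simp only [map_add, hN, hM]⟩

lemma IsPolyFun.mul (hf : IsPolyFun f) (hg : IsPolyFun g) : IsPolyFun fun p => f p * g p := by
  obtain ⟨N, hN⟩ := hf
  obtain ⟨M, hM⟩ := hg
  exact ⟨N * M, fun p => by simp only [map_mul, hN, hM]⟩

lemma IsPolyFun.const (a : ℂ) : IsPolyFun fun _ : Params n => a :=
  ⟨MvPolynomial.C (MvPolynomial.C a), fun p => by simp [evalParams]⟩

lemma IsPolyFun.neg (hf : IsPolyFun f) : IsPolyFun fun p => -f p := by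
  simpa using (IsPolyFun.const (-1)).mul hf

lemma IsPolyFun.sub (hf : IsPolyFun f) (hg : IsPolyFun g) : IsPolyFun fun p => f p - g p := by
  simpa [sub_eq_add_neg] using hf.add hg.neg

lemma IsPolyFun.pow (hf : IsPolyFun f) (k : ℕ) : IsPolyFun fun p => f p ^ k := by
  obtain ⟨N, hN⟩ := hf
  exact ⟨N ^ k, fun p => by simp only [map_pow, hN]⟩

lemma IsPolyFun.prod {ι : Type*} {s : Finset ι} {f : ι → Params n → ℂ}
    (h : ∀ i, IsPolyFun (f i)) : IsPolyFun fun p => ∏ i ∈ s, f i p := by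
  choose N hN using h
  exact ⟨∏ i ∈ s, N i, fun p => by simp [hN]⟩

lemma IsPolyFun.q : IsPolyFun (Params.q (n := n)) :=
  ⟨MvPolynomial.C (MvPolynomial.X 0), fun p => by simp [evalParams]⟩

lemma IsPolyFun.t : IsPolyFun (Params.t (n := n)) :=
  ⟨MvPolynomial.C (MvPolynomial.X 1), fun p => by simp [evalParams]⟩

lemma IsPolyFun.u : IsPolyFun (Params.u (n := n)) :=
  ⟨MvPolynomial.C (MvPolynomial.X 2), fun p => by simp [evalParams]⟩

lemma IsPolyFun.v : IsPolyFun (Params.v (n := n)) :=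
  ⟨MvPolynomial.C (MvPolynomial.X 3), fun p => by simp [evalParams]⟩

lemma IsPolyFun.x (k : Fin n) : IsPolyFun fun p : Params n => p.x k :=
  ⟨MvPolynomial.X k, fun p => by simp [evalParams]⟩

end Params

/-! ### Normal ordering of words -/

section NormalOrder
variable {r n : ℕ}

/-- The coefficient with which `φ†ᵃ k^b φ^c` maps `|m⟩` to `|m - c + a⟩` for a single boson. It
vanishes for `m < c`, because of the factor with index `m`. -/
def normWt (t : ℂ) (b c m : ℕ) : ℂ := (∏ i ∈ range c, (1 - t ^ (m - i))) * t ^ (b * (m - c))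

lemma normWt_eq_zero (t : ℂ) (b : ℕ) {c m : ℕ} (h : m < c) : normWt t b c m = 0 := by
  rw [normWt, Finset.prod_eq_zero (mem_range.2 h) (by simp), zero_mul]

lemma normWt_succ_left (t : ℂ) (b c m : ℕ) :
    normWt t (b + 1) c m = normWt t b c m * t ^ (m - c) := by
  rw [normWt, normWt, mul_assoc, ← pow_add]
  congr 2; ring

lemma normWt_succ_right (t : ℂ) (b c m : ℕ) :
    t ^ b * normWt t b (c + 1) m = normWt t b c m * (1 - t ^ (m - c)) := by
  rcases le_or_gt m c with h | h
  · rw [normWt_eq_zero t b (by omega : m < c + 1), Nat.sub_eq_zero_of_le h]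
    simp
  · obtain ⟨k, rfl⟩ : ∃ k, m = c + 1 + k := ⟨m - (c + 1), by omega⟩
    rw [normWt, normWt, Finset.prod_range_succ, show c + 1 + k - (c + 1) = k by omega,
      show c + 1 + k - c = k + 1 by omega]
    ring

/-- The normally ordered operator `∏_s φ†_s ^ a_s k_s ^ b_s φ_s ^ c_s`. The exponents are indexed by
the bosons, like occupation numbers. -/
def normOp (t : ℂ) (a b c : State r) : Module.End ℂ (Fock r) :=
  opOfKets fun m => (∏ s, normWt t (b s) (c s) (m s)) • ket fun s => m s - c s + a s

lemma normOp_ket (t : ℂ) (a b c m : State r) : normOp t a b c (ket m) =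
    (∏ s, normWt t (b s) (c s) (m s)) • ket fun s => m s - c s + a s := opOfKets_ket _ _

lemma normOp_zero (t : ℂ) : normOp t (0 : State r) 0 0 = 1 := by
  refine end_ext fun m => ?_
  rw [normOp_ket]
  simp [normWt]

lemma phiDag_mul_normOp (t : ℂ) (s : Fin r × Fin r) (a b c : State r) :
    phiDag s * normOp t a b c = normOp t (a + Pi.single s 1) b c := by
  refine end_ext fun m => ?_
  rw [Module.End.mul_apply, normOp_ket, normOp_ket, map_smul, phiDag_ket]
  congr 2
  funext s'
  rcases eq_or_ne s' s with rfl | h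
  · simp [add_assoc]
  · simp [h]

lemma prod_normWt_add (t : ℂ) (s : Fin r × Fin r) (b c m : State r) (i j : ℕ) :
    ∏ s', normWt t ((b + Pi.single s i : State r) s') ((c + Pi.single s j : State r) s') (m s') =
      normWt t (b s + i) (c s + j) (m s) * ∏ s' ∈ {s}ᶜ, normWt t (b s') (c s') (m s') := by
  rw [Fintype.prod_eq_mul_prod_compl s]
  congr 1
  · simp
  · refine Finset.prod_congr rfl fun s' hs => ?_
    have hs : s' ≠ s := by simpa using hs
    simp [hs]

/-- Moving `k_s` to the right past `a_s` creation operators `φ†_s` produces `t ^ a_s`. -/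
lemma kOp_mul_normOp (t : ℂ) (s : Fin r × Fin r) (a b c : State r) :
    kOp t s * normOp t a b c = t ^ a s • normOp t a (b + Pi.single s 1) c := by
  refine end_ext fun m => ?_
  have h1 := prod_normWt_add t s b c m 1 0
  have h0 := prod_normWt_add t s b c m 0 0
  simp only [Pi.single_zero, add_zero] at h0 h1
  rw [Module.End.mul_apply, normOp_ket, map_smul, kOp_ket, LinearMap.smul_apply, normOp_ket, h0,
    h1, normWt_succ_left, smul_smul, smul_smul, pow_add]
  congr 1; ring

/-- Moving an annihilation operator to the right past creation operators. -/
lemma phi_mul_normOp (t : ℂ) (s : Fin r × Fin r) (a b c : State r) :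
    phi t s * normOp t a b c = t ^ b s • normOp t a b (c + Pi.single s 1) +
      (1 - t ^ a s) • normOp t (a - Pi.single s 1) (b + Pi.single s 1) c := by
  refine end_ext fun m => ?_
  have h0 := prod_normWt_add t s b c m 0 0
  have h1 := prod_normWt_add t s b c m 1 0
  have h2 := prod_normWt_add t s b c m 0 1
  simp only [Pi.single_zero, add_zero] at h0 h1 h2
  rw [Module.End.mul_apply, normOp_ket, map_smul, phi_ket, LinearMap.add_apply,
    LinearMap.smul_apply, LinearMap.smul_apply, normOp_ket, normOp_ket, h0, h1, h2,
    normWt_succ_left]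
  set R := ∏ s' ∈ {s}ᶜ, normWt t (b s') (c s') (m s')
  set st := Function.update (fun s => m s - c s + a s) s (m s - c s + a s - 1) with hst
  have e1 : m s < c s + 1 ∨
      (fun s' => m s' - (c + Pi.single s 1 : State r) s' + a s') = st := by
    by_cases h : m s < c s + 1
    · exact Or.inl h
    · right
      funext s'
      rcases eq_or_ne s' s with rfl | hs
      · simp [hst]; omega
      · simp [hst, hs]
  have e2 : a s = 0 ∨ (fun s' => m s' - c s' + (a - Pi.single s 1 : State r) s') = st := by
    by_cases h : a s = 0
    · exact Or.inl h
    · right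
      funext s'
      rcases eq_or_ne s' s with rfl | hs
      · simp [hst]; omega
      · simp [hst, hs]
  have t1 : (t ^ b s • (normWt t (b s) (c s + 1) (m s) * R) •
      ket (fun s' => m s' - (c + Pi.single s 1 : State r) s' + a s') : Fock r) =
      (normWt t (b s) (c s) (m s) * (1 - t ^ (m s - c s)) * R) • ket st := by
    rw [smul_smul, ← mul_assoc, normWt_succ_right]
    rcases e1 with h | h
    · rw [Nat.sub_eq_zero_of_le (by omega)]; simp
    · rw [h]
  have t2 : ((1 - t ^ a s) • (normWt t (b s) (c s) (m s) * t ^ (m s - c s) * R) •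
      ket (fun s' => m s' - c s' + (a - Pi.single s 1 : State r) s') : Fock r) =
      ((1 - t ^ a s) * (normWt t (b s) (c s) (m s) * t ^ (m s - c s) * R)) • ket st := by
    rcases e2 with h | h
    · rw [h]; simp
    · rw [h, smul_smul]
  rw [t1, t2, smul_smul, ← add_smul, pow_add]
  congr 1; ring

/-- The families of operators that are combinations, with coefficients polynomial in the
parameters, of normally ordered operators in which the total degree in `k_s` and `φ_s` is at most
`κ s`. -/
def normSpan (κ : State r) : Submodule ℂ (Params n → Module.End ℂ (Fock r)) :=
  Submodule.span ℂ {X | ∃ (f : Params n → ℂ) (a b c : State r), IsPolyFun f ∧ b + c ≤ κ ∧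
    X = fun p => f p • normOp p.t a b c}

lemma mem_normSpan {κ : State r} {f : Params n → ℂ} (hf : IsPolyFun f) {a b c : State r}
    (h : b + c ≤ κ) : (fun p => f p • normOp p.t a b c) ∈ normSpan κ :=
  Submodule.subset_span ⟨f, a, b, c, hf, h, rfl⟩

lemma normSpan_mono {κ κ' : State r} (h : κ ≤ κ') : normSpan (n := n) κ ≤ normSpan κ' :=
  Submodule.span_mono fun _ ⟨f, a, b, c, hf, hbc, hX⟩ => ⟨f, a, b, c, hf, hbc.trans h, hX⟩

/-- Multiplication by the family `Y` from the left raises degrees by at most `δ`. -/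
def HasDegree (Y : Params n → Module.End ℂ (Fock r)) (δ : State r) : Prop :=
  ∀ κ, ∀ X ∈ normSpan κ, Y * X ∈ normSpan (κ + δ)

lemma HasDegree.of_generators {Y : Params n → Module.End ℂ (Fock r)} {δ : State r}
    (h : ∀ (f : Params n → ℂ), IsPolyFun f → ∀ (a b c : State r),
      (fun p => f p • (Y p * normOp p.t a b c)) ∈ normSpan (b + c + δ)) : HasDegree Y δ := by
  intro κ X hX
  refine Submodule.span_induction ?_ ?_ ?_ ?_ hX
  · rintro _ ⟨f, a, b, c, hf, hbc, rfl⟩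
    have := normSpan_mono (add_le_add_left hbc δ) (h f hf a b c)
    convert this using 1
    funext p
    simp
  · simp
  · intro X Z _ _ hX hZ
    rw [mul_add]
    exact add_mem hX hZ
  · intro a X _ hX
    rw [mul_smul_comm]
    exact Submodule.smul_mem _ _ hX

variable {Y Z : Params n → Module.End ℂ (Fock r)} {δ ε : State r}

lemma HasDegree.mul (hY : HasDegree Y δ) (hZ : HasDegree Z ε) : HasDegree (Y * Z) (δ + ε) := by
  intro κ X hX
  rw [mul_assoc, add_comm δ, ← add_assoc]
  exact hY _ _ (hZ _ _ hX)

lemma HasDegree.mono (hY : HasDegree Y δ) (h : δ ≤ ε) : HasDegree Y ε := fun κ X hX =>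
  normSpan_mono (add_le_add_right h κ) (hY κ X hX)

lemma HasDegree.add (hY : HasDegree Y δ) (hZ : HasDegree Z δ) : HasDegree (Y + Z) δ := by
  intro κ X hX
  rw [add_mul]
  exact add_mem (hY κ X hX) (hZ κ X hX)

lemma HasDegree.sum {ι : Type*} {s : Finset ι} {Y : ι → Params n → Module.End ℂ (Fock r)}
    (h : ∀ i, HasDegree (Y i) δ) : HasDegree (fun p => ∑ i ∈ s, Y i p) δ := by
  intro κ X hX
  have : (fun p => ∑ i ∈ s, Y i p) * X = ∑ i ∈ s, Y i * X := by
    funext p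
    simp [Finset.sum_mul]
  rw [this]
  exact sum_mem fun i _ => h i κ X hX

lemma HasDegree.polyFun {f : Params n → ℂ} (hf : IsPolyFun f) :
    HasDegree (r := r) (fun p => f p • 1) 0 := by
  refine HasDegree.of_generators fun g hg a b c => ?_
  rw [add_zero]
  convert mem_normSpan (hg.mul hf) (a := a) (le_refl (b + c)) using 1
  funext p
  simp [smul_smul]

lemma HasDegree.one : HasDegree (1 : Params n → Module.End ℂ (Fock r)) 0 := by
  intro κ X hX
  simpa using hX

lemma HasDegree.smul {f : Params n → ℂ} (hY : HasDegree Y δ) (hf : IsPolyFun f) :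
    HasDegree (fun p => f p • Y p) δ := by
  have := (HasDegree.polyFun hf).mul hY
  rw [zero_add] at this
  convert this using 1
  funext p
  simp

lemma HasDegree.sub (hY : HasDegree Y δ) (hZ : HasDegree Z δ) :
    HasDegree (fun p => Y p - Z p) δ := by
  convert hY.add (hZ.smul (IsPolyFun.const (-1))) using 1
  funext p
  simp only [Pi.add_apply]
  module

lemma hasDegree_phiDag (s : Fin r × Fin r) : HasDegree (fun _ : Params n => phiDag s) 0 := by
  refine HasDegree.of_generators fun f hf a b c => ?_
  simp only [phiDag_mul_normOp]
  exact mem_normSpan hf le_rfl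

lemma hasDegree_kOp (s : Fin r × Fin r) :
    HasDegree (fun p : Params n => kOp p.t s) (Pi.single s 1) := by
  refine HasDegree.of_generators fun f hf a b c => ?_
  simp only [kOp_mul_normOp, smul_smul]
  exact mem_normSpan (hf.mul (IsPolyFun.t.pow _)) (by rw [add_right_comm])

lemma hasDegree_phi (s : Fin r × Fin r) :
    HasDegree (fun p : Params n => phi p.t s) (Pi.single s 1) := by
  refine HasDegree.of_generators fun f hf a b c => ?_
  simp only [phi_mul_normOp, smul_add, smul_smul]
  refine add_mem (mem_normSpan (hf.mul (IsPolyFun.t.pow _)) (by rw [add_assoc]))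
    (mem_normSpan (hf.mul ((IsPolyFun.const 1).sub (IsPolyFun.t.pow _))) (by rw [add_right_comm]))

/-- Degree one in each boson of copy `c`. -/
def copyDeg (c : Fin r) : State r := fun s => if s.2 = c then 1 else 0

lemma single_le_copyDeg (i c : Fin r) : (Pi.single (i, c) 1 : State r) ≤ copyDeg c := by
  intro s
  rcases eq_or_ne s (i, c) with rfl | h
  · simp [copyDeg]
  · simp [h]

lemma hasDegree_kList (c : Fin r) {l : List (Fin r)} (hl : l.Nodup) :
    HasDegree (fun p : Params n => (l.map fun i => kOp p.t (i, c)).prod) (copyDeg c) := by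
  have key : HasDegree (fun p : Params n => (l.map fun i => kOp p.t (i, c)).prod)
      fun s => if s.2 = c then l.count s.1 else 0 := by
    clear hl
    induction l with
    | nil =>
      simp only [List.map_nil, List.prod_nil, List.count_nil, ite_self]
      exact HasDegree.one
    | cons i l ih =>
      simp only [List.map_cons, List.prod_cons]
      refine ((hasDegree_kOp (i, c)).mul ih).mono fun s => ?_
      rcases eq_or_ne s (i, c) with rfl | h
      · simp [add_comm]
      · simp only [Pi.add_apply, Pi.single_apply, h, if_false, zero_add]
        split_ifs
        · exact List.count_le_count_cons
        · exact le_rfl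
  refine key.mono fun s => ?_
  by_cases h : s.2 = c
  · simpa [copyDeg, h] using List.nodup_iff_count_le_one.1 hl s.1
  · simp [h]

lemma hasDegree_LMat (k : Fin n) (c : Fin r) (a b : Fin (r + 1)) :
    HasDegree (fun p : Params n => LMat p.t p.u p.v (p.x k) c a b) (copyDeg c + copyDeg c) := by
  have hAll : HasDegree (fun p : Params n => kAll p.t c) (copyDeg c) :=
    hasDegree_kList c (List.nodup_finRange r)
  have hAbove : ∀ i, HasDegree (fun p : Params n => kAbove p.t i c) (copyDeg c) := fun i =>
    hasDegree_kList c ((List.nodup_finRange r).filter _)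
  have hphi : ∀ i, HasDegree (fun p : Params n => phi p.t (i, c)) (copyDeg c) := fun i =>
    (hasDegree_phi (i, c)).mono (single_le_copyDeg i c)
  have hk : ∀ i, HasDegree (fun p : Params n => kOp p.t (i, c)) (copyDeg c) := fun i =>
    (hasDegree_kOp (i, c)).mono (single_le_copyDeg i c)
  have h1 : HasDegree (1 : Params n → Module.End ℂ (Fock r)) (copyDeg c) :=
    HasDegree.one.mono zero_le
  have hle : copyDeg c ≤ copyDeg c + copyDeg c := le_self_add
  have hx := IsPolyFun.x k
  refine Fin.cases ?_ (fun i => ?_) a <;> refine Fin.cases ?_ (fun j => ?_) b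
  · exact (h1.sub (hAll.smul (IsPolyFun.u.mul hx))).mono hle
  · exact (h1.sub (hAll.smul (IsPolyFun.u.mul IsPolyFun.v))).mul (hphi j)
  · exact (((hAbove i).mul (hasDegree_phiDag (i, c))).smul hx).mono (by simp)
  · by_cases hij : i = j
    · simp only [LMat, Matrix.of_apply, Fin.cases_succ, hij, if_true]
      exact ((h1.smul hx).sub ((hk j).smul IsPolyFun.v)).mul (hAbove j)
    · have h3 : HasDegree (fun p : Params n => kAbove p.t i c * phiDag (i, c) * phi p.t (j, c))
          (copyDeg c + copyDeg c) := by
        have := ((hAbove i).mul (hasDegree_phiDag (i, c))).mul (hphi j)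
        rw [add_zero] at this
        exact this
      by_cases hji : j < i
      · simp only [LMat, Matrix.of_apply, Fin.cases_succ, hij, hji, if_true, if_false]
        exact h3.smul hx
      · simp only [LMat, Matrix.of_apply, Fin.cases_succ, hij, hji, if_false]
        exact h3.smul IsPolyFun.v

lemma hasDegree_partialMonodromy (k : Fin n) (cs : List (Fin r)) (a b : Fin (r + 1)) :
    HasDegree (fun p : Params n => partialMonodromy p.t p.u p.v (p.x k) cs a b)
      fun s => 2 * cs.count s.2 := by
  induction cs generalizing a with
  | nil =>
    simp only [partialMonodromy, List.map_nil, List.prod_nil, List.count_nil, mul_zero,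
      Matrix.one_apply]
    split_ifs
    · exact HasDegree.one
    · intro κ X _
      have : (fun _ : Params n => (0 : Module.End ℂ (Fock r))) * X = 0 := zero_mul X
      rw [this]
      exact zero_mem _
  | cons c cs ih =>
    simp only [partialMonodromy_cons]
    refine HasDegree.sum fun d => ((hasDegree_LMat k c a d).mul (ih d)).mono fun s => ?_
    by_cases h : s.2 = c
    · subst h
      simp [copyDeg]
      omega
    · simp [copyDeg, h, Ne.symm h]

lemma hasDegree_opA (k : Fin n) (a : Fin (r + 1)) :
    HasDegree (fun p : Params n => opA r p.t p.u p.v a (p.x k)) fun _ => 2 :=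
  (hasDegree_partialMonodromy k (List.finRange r) a 0).mono fun s => by
    exact Nat.mul_le_mul_left 2 (List.nodup_iff_count_le_one.1 (List.nodup_finRange r) s.2)

/-- Each factor of a word contributes degree two in every boson. -/
lemma opAWord_mem_normSpan (μ : Fin n → Fin (r + 1)) :
    (fun p : Params n => opAWord r p.t p.u p.v μ p.x) ∈ normSpan fun _ => 2 * n := by
  have key : ∀ l : List (Fin n), HasDegree
      (fun p : Params n => (l.map fun k => opA r p.t p.u p.v (μ k) (p.x k)).prod)
      fun _ => 2 * l.length := by
    intro l
    induction l with
    | nil => exact HasDegree.one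
    | cons k l ih =>
      simp only [List.map_cons, List.prod_cons, List.length_cons]
      refine ((hasDegree_opA k (μ k)).mul ih).mono fun s => ?_
      simp only [Pi.add_apply]
      omega
  have h1 : (1 : Params n → Module.End ℂ (Fock r)) ∈ normSpan 0 := by
    have := mem_normSpan (r := r) (n := n) (IsPolyFun.const 1) (a := 0) (b := 0) (c := 0)
      (κ := 0) (by simp)
    simp only [normOp_zero, one_smul] at this
    exact this
  have := key (List.finRange n) 0 1 h1
  simpa [opAWord, List.ofFn_eq_map, Pi.mul_def] using this

end NormalOrder

/-! ### Geometric series -/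

section Sums

lemma hasSum_congr {ι : Type*} {f g : ι → ℂ} {a b : ℂ} (h : HasSum f a) (hf : ∀ k, g k = f k)
    (hb : b = a) : HasSum g b := by
  rw [hb, funext hf]
  exact h

lemma summable_mul_prod {ι κ : Type*} {f : ι → ℂ} {g : κ → ℂ} (hf : Summable f)
    (hg : Summable g) : Summable fun x : ι × κ => f x.1 * g x.2 :=
  summable_mul_of_summable_norm hf.norm hg.norm

lemma hasSum_mul_prod {ι κ : Type*} {f : ι → ℂ} {g : κ → ℂ} {a b : ℂ} (hf : HasSum f a)
    (hg : HasSum g b) : HasSum (fun x : ι × κ => f x.1 * g x.2) (a * b) :=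
  hf.mul hg (summable_mul_prod hf.summable hg.summable)

lemma hasSum_pi_prod_equiv {α β : Type*} [Fintype α] [Fintype β] (e : α ≃ β) (f : β → ℕ → ℂ)
    (S : β → ℂ) (h : HasSum (fun c : α → ℕ => ∏ i, f (e i) (c i)) (∏ i, S (e i))) :
    HasSum (fun c : β → ℕ => ∏ i, f i (c i)) (∏ i, S i) := by
  have h1 := (Equiv.arrowCongr e.symm (Equiv.refl ℕ)).hasSum_iff.2 h
  refine hasSum_congr h1 (fun c => ?_) (e.prod_comp S).symm
  exact (e.prod_comp fun i => f i (c i)).symm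

/-- Summation over all occupation numbers factorises. -/
lemma hasSum_pi_prod {ι : Type*} [Fintype ι] (f : ι → ℕ → ℂ) (S : ι → ℂ)
    (h : ∀ i, HasSum (f i) (S i)) : HasSum (fun c : ι → ℕ => ∏ i, f i (c i)) (∏ i, S i) := by
  have key : ∀ (N : ℕ) (f : Fin N → ℕ → ℂ) (S : Fin N → ℂ), (∀ i, HasSum (f i) (S i)) →
      HasSum (fun c : Fin N → ℕ => ∏ i, f i (c i)) (∏ i, S i) := by
    intro N
    induction N with
    | zero =>
      intro f S _
      simp only [Finset.univ_eq_empty, Finset.prod_empty]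
      exact hasSum_unique (fun _ : Fin 0 → ℕ => (1 : ℂ))
    | succ N ih =>
      intro f S h
      have h1 := ih (fun i => f i.succ) (fun i => S i.succ) fun i => h i.succ
      have h2 := hasSum_mul_prod (h 0) h1
      have h3 := (Fin.consEquiv fun _ : Fin (N + 1) => ℕ).symm.hasSum_iff.2 h2
      exact hasSum_congr h3 (fun c => Fin.prod_univ_succ _) (Fin.prod_univ_succ _)
  exact hasSum_pi_prod_equiv (Fintype.equivFin ι).symm f S (key _ _ _ fun i => h _)

variable {n : ℕ}

lemma norm_pow_mul_pow_lt_one {q t : ℂ} (h : ConvergenceDomain n q t) {l j : ℕ} (hl : l ≠ 0)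
    (hj : j ≤ 2 * n) : ‖q ^ l * t ^ j‖ < 1 := by
  obtain ⟨h1, h2⟩ := h
  have h3 : ‖q‖ * ‖t‖ ^ j < 1 := by
    rcases le_total ‖t‖ 1 with ht | ht
    · exact lt_of_le_of_lt (mul_le_of_le_one_right (norm_nonneg _)
        (pow_le_one₀ (norm_nonneg _) ht)) h1
    · exact lt_of_le_of_lt (mul_le_mul_of_nonneg_left (pow_le_pow_right₀ ht hj)
        (norm_nonneg _)) h2
  rw [norm_mul, norm_pow, norm_pow]
  refine lt_of_le_of_lt (mul_le_mul_of_nonneg_right ?_ (pow_nonneg (norm_nonneg _) _)) h3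
  exact pow_le_of_le_one (norm_nonneg _) h1.le hl

/-- The denominator of a trace over one boson with twist `q ^ l`. -/
def bosonDenom (n l : ℕ) (q t : ℂ) : ℂ := ∏ j ∈ range (2 * n + 1), (1 - q ^ l * t ^ j)

lemma one_sub_ne_zero {z : ℂ} (h : ‖z‖ < 1) : 1 - z ≠ 0 := by
  intro h0
  rw [sub_eq_zero] at h0
  rw [← h0, norm_one] at h
  exact lt_irrefl _ h

lemma bosonDenom_ne_zero {q t : ℂ} (h : ConvergenceDomain n q t) {l : ℕ} (hl : l ≠ 0) :
    bosonDenom n l q t ≠ 0 :=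
  Finset.prod_ne_zero_iff.2 fun j hj =>
    one_sub_ne_zero (norm_pow_mul_pow_lt_one h hl (by rw [mem_range] at hj; omega))

/-- The sums over one occupation number are geometric series, after the factors coming from the
annihilation operators have been multiplied out. -/
lemma exists_hasSum_boson {l : ℕ} (hl : l ≠ 0) (e : ℕ → ℕ) (c : ℕ) :
    ∀ b, b + c ≤ 2 * n → ∃ N : Params n → ℂ, IsPolyFun N ∧ ∀ p : Params n,
      ConvergenceDomain n p.q p.t →
      HasSum (fun k => (∏ i ∈ range c, (1 - p.t ^ (e i + k))) * p.t ^ (b * k) * (p.q ^ l) ^ k)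
        (N p / bosonDenom n l p.q p.t) := by
  induction c with
  | zero =>
    intro b hb
    refine ⟨fun p => ∏ j ∈ (range (2 * n + 1)).erase b, (1 - p.q ^ l * p.t ^ j),
      IsPolyFun.prod fun j => (IsPolyFun.const 1).sub
        ((IsPolyFun.q.pow _).mul (IsPolyFun.t.pow _)), fun p hp => ?_⟩
    have hlt := norm_pow_mul_pow_lt_one hp hl (j := b) (by omega)
    have hmem : b ∈ range (2 * n + 1) := by rw [mem_range]; omega
    have hD := bosonDenom_ne_zero hp hl
    have heq : (∏ j ∈ (range (2 * n + 1)).erase b, (1 - p.q ^ l * p.t ^ j)) /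
        bosonDenom n l p.q p.t = (1 - p.q ^ l * p.t ^ b)⁻¹ := by
      rw [div_eq_iff hD, bosonDenom, ← Finset.mul_prod_erase _ _ hmem,
        inv_mul_cancel_left₀ (one_sub_ne_zero hlt)]
    rw [heq]
    refine hasSum_congr (hasSum_geometric_of_norm_lt_one hlt) (fun k => ?_) rfl
    rw [Finset.prod_range_zero, pow_mul, mul_pow]
    ring
  | succ c ih =>
    intro b hb
    obtain ⟨N₁, h₁, H₁⟩ := ih b (by omega)
    obtain ⟨N₂, h₂, H₂⟩ := ih (b + 1) (by omega)
    refine ⟨fun p => N₁ p - p.t ^ e c * N₂ p, h₁.sub ((IsPolyFun.t.pow _).mul h₂),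
      fun p hp => ?_⟩
    refine hasSum_congr ((H₁ p hp).sub ((H₂ p hp).mul_left (p.t ^ e c))) (fun k => ?_) ?_
    · rw [Finset.prod_range_succ]
      ring
    · simp only
      ring

/-- The summand of the trace over one boson of `φ†ᵃ k^b φ^c`. -/
def bosonTerm (l a b c : ℕ) (q t : ℂ) (k : ℕ) : ℂ :=
  normWt t b c k * (q ^ l) ^ k * if k - c + a = k then 1 else 0

/-- For `a ≠ c` the trace vanishes; for `a = c` the first `c` summands vanish, and after a shift of
the summation index no negative powers of `t` remain. -/
lemma exists_hasSum_bosonTerm {l : ℕ} (hl : l ≠ 0) (a : ℕ) {b c : ℕ} (h : b + c ≤ 2 * n) :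
    ∃ N : Params n → ℂ, IsPolyFun N ∧ ∀ p : Params n, ConvergenceDomain n p.q p.t →
      HasSum (bosonTerm l a b c p.q p.t) (N p / bosonDenom n l p.q p.t) := by
  by_cases hac : a = c
  · subst hac
    obtain ⟨N, hN, H⟩ := exists_hasSum_boson hl (fun i => a - i) a b h
    refine ⟨fun p => (p.q ^ l) ^ a * N p, ((IsPolyFun.q.pow _).pow _).mul hN, fun p hp => ?_⟩
    have h0 : ∑ i ∈ range a, bosonTerm l a b a p.q p.t i = 0 :=
      Finset.sum_eq_zero fun i hi => by
        rw [bosonTerm, normWt_eq_zero _ _ (mem_range.1 hi), zero_mul, zero_mul]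
    have := (hasSum_nat_add_iff (f := bosonTerm l a b a p.q p.t) a
      (g := (p.q ^ l) ^ a * N p / bosonDenom n l p.q p.t)).1 ?_
    · rwa [h0, add_zero] at this
    · rw [mul_div_assoc]
      refine hasSum_congr ((H p hp).mul_left ((p.q ^ l) ^ a)) (fun k => ?_) rfl
      rw [bosonTerm, normWt, Nat.add_sub_cancel, if_pos rfl]
      have : ∏ i ∈ range a, (1 - p.t ^ (k + a - i)) = ∏ i ∈ range a, (1 - p.t ^ (a - i + k)) :=
        Finset.prod_congr rfl fun i hi => by
          rw [mem_range] at hi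
          rw [show k + a - i = a - i + k by omega]
      rw [this]
      ring
  · refine ⟨fun _ => 0, IsPolyFun.const 0, fun p _ => ?_⟩
    have : bosonTerm l a b c p.q p.t = fun _ => 0 := by
      funext k
      rcases lt_or_ge k c with hk | hk
      · rw [bosonTerm, normWt_eq_zero _ _ hk, zero_mul, zero_mul]
      · rw [bosonTerm, if_neg (by omega), mul_zero]
    rw [this, zero_div]
    exact hasSum_zero

end Sums

/-! ### Convergence and rationality of the linear form -/

section Bracket
variable {r n : ℕ}

lemma formTerm_add (X Y : Module.End ℂ (Fock r)) (d : Fin r → ℕ) (c : TracedConf r) :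
    formTerm (X + Y) d c = formTerm X d c + formTerm Y d c := by
  simp [formTerm, matrixElement]

lemma formTerm_smul (a : ℂ) (X : Module.End ℂ (Fock r)) (d : Fin r → ℕ) (c : TracedConf r) :
    formTerm (a • X) d c = a * formTerm X d c := by
  simp [formTerm, matrixElement]

/-- The contribution of the bosons that are not traced over. -/
def vacuumTerm (t : ℂ) (a b c : State r) (d : Fin r → ℕ) : ℂ :=
  ∏ s : {s : Fin r × Fin r // ¬ s.2 < s.1}, normWt t (b s) (c s) 0 *
    if a s = (if s.1.1 = s.1.2 then d s.1.1 else 0) then 1 else 0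

/-- On a normally ordered operator the linear form factorises over the bosons. -/
lemma formTerm_normOp (q t : ℂ) (a b c : State r) (d : Fin r → ℕ) (m : TracedConf r) :
    formTerm (normOp t a b c * twist r q) d m = vacuumTerm t a b c d *
      ∏ s : {s : Fin r × Fin r // s.2 < s.1},
        bosonTerm ((s.1.1 : ℕ) - (s.1.2 : ℕ)) (a s) (b s) (c s) q t (m s) := by
  have hket : ∀ x y : State r, (ket x : Fock r) y = ∏ s, if x s = y s then 1 else 0 := by
    intro x y
    rw [Finset.prod_ite_zero, ket, Finsupp.single_apply]
    simp [funext_iff]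
  rw [formTerm_mul_twist, formTerm, matrixElement, normOp_ket, Finsupp.smul_apply, hket, twistWt,
    smul_eq_mul, ← Finset.prod_mul_distrib, ← Finset.prod_mul_distrib,
    ← Fintype.prod_subtype_mul_prod_subtype (fun s : Fin r × Fin r => s.2 < s.1), mul_comm]
  congr 1
  · refine Finset.prod_congr rfl fun s _ => ?_
    simp [stateOf, s.2]
  · refine Finset.prod_congr rfl fun s _ => ?_
    simp only [stateOf, s.2, dif_pos, if_true, bosonTerm]
    ring

/-- The creation operators of the diagonal bosons determine `d`. -/
lemma summable_vacuumTerm (t : ℂ) (a b c : State r) : Summable (vacuumTerm t a b c) := by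
  refine summable_of_ne_finset_zero (s := {fun i => a (i, i)}) fun d hd => ?_
  rw [mem_singleton] at hd
  obtain ⟨i, hi⟩ := Function.ne_iff.1 hd
  refine Finset.prod_eq_zero (mem_univ ⟨(i, i), lt_irrefl i⟩) ?_
  simp [Ne.symm hi]

/-- The common denominator of all brackets. -/
def denom (n r : ℕ) (q t : ℂ) : ℂ :=
  ∏ s : {s : Fin r × Fin r // s.2 < s.1}, bosonDenom n ((s.1.1 : ℕ) - (s.1.2 : ℕ)) q t

lemma twist_exponent_ne_zero (s : {s : Fin r × Fin r // s.2 < s.1}) :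
    (s.1.1 : ℕ) - (s.1.2 : ℕ) ≠ 0 := by
  have := s.2
  omega

lemma denom_ne_zero {q t : ℂ} (h : ConvergenceDomain n q t) : denom n r q t ≠ 0 :=
  Finset.prod_ne_zero_iff.2 fun s _ => bosonDenom_ne_zero h (twist_exponent_ne_zero s)

/-- The sums defining the linear form converge, on the whole domain, and the values of the
brackets are rational with the denominator `denom`. -/
structure IsRational (X : Params n → Module.End ℂ (Fock r)) : Prop where
  summable : ∀ p : Params n, ConvergenceDomain n p.q p.t →
    Summable fun dc : (Fin r → ℕ) × TracedConf r => formTerm (X p * twist r p.q) dc.1 dc.2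
  bracket : ∀ d : Fin r → ℕ, ∃ N : Params n → ℂ, IsPolyFun N ∧ ∀ p : Params n,
    ConvergenceDomain n p.q p.t → bracket d (X p * twist r p.q) = N p / denom n r p.q p.t

lemma bracket_add {X Y : Module.End ℂ (Fock r)}
    (hX : Summable fun dc : (Fin r → ℕ) × TracedConf r => formTerm X dc.1 dc.2)
    (hY : Summable fun dc : (Fin r → ℕ) × TracedConf r => formTerm Y dc.1 dc.2)
    (d : Fin r → ℕ) : bracket d (X + Y) = bracket d X + bracket d Y := by
  simp only [bracket, formTerm_add]
  exact (hX.prod_factor d).tsum_add (hY.prod_factor d)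

lemma bracket_smul (a : ℂ) (X : Module.End ℂ (Fock r)) (d : Fin r → ℕ) :
    bracket d (a • X) = a * bracket d X := by
  simp only [bracket, formTerm_smul, tsum_mul_left]

lemma isRational_normOp {f : Params n → ℂ} (hf : IsPolyFun f) {a b c : State r}
    (h : b + c ≤ fun _ => 2 * n) : IsRational fun p : Params n => f p • normOp p.t a b c := by
  choose N hN H using fun s : {s : Fin r × Fin r // s.2 < s.1} =>
    exists_hasSum_bosonTerm (n := n) (twist_exponent_ne_zero s) (a s) (h s.1)
  have hsum : ∀ p : Params n, ConvergenceDomain n p.q p.t →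
      HasSum (fun m : TracedConf r => ∏ s : {s : Fin r × Fin r // s.2 < s.1},
        bosonTerm ((s.1.1 : ℕ) - (s.1.2 : ℕ)) (a s) (b s) (c s) p.q p.t (m s))
        (∏ s, N s p / bosonDenom n ((s.1.1 : ℕ) - (s.1.2 : ℕ)) p.q p.t) :=
    fun p hp => hasSum_pi_prod _ _ fun s => H s p hp
  have hform : ∀ (p : Params n) (d : Fin r → ℕ) (m : TracedConf r),
      formTerm ((f p • normOp p.t a b c) * twist r p.q) d m =
        (f p * vacuumTerm p.t a b c d) * ∏ s : {s : Fin r × Fin r // s.2 < s.1},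
          bosonTerm ((s.1.1 : ℕ) - (s.1.2 : ℕ)) (a s) (b s) (c s) p.q p.t (m s) := by
    intro p d m
    rw [smul_mul_assoc, formTerm_smul, formTerm_normOp, mul_assoc]
  constructor
  · intro p hp
    simp only [hform]
    have h1 : Summable fun d => f p * vacuumTerm p.t a b c d :=
      (summable_vacuumTerm p.t a b c).mul_left (f p)
    exact summable_mul_prod (f := fun d => f p * vacuumTerm p.t a b c d)
      (g := fun m : TracedConf r => ∏ s : {s : Fin r × Fin r // s.2 < s.1},
        bosonTerm ((s.1.1 : ℕ) - (s.1.2 : ℕ)) (a s) (b s) (c s) p.q p.t (m s))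
      h1 (hsum p hp).summable
  · intro d
    refine ⟨fun p => f p * vacuumTerm p.t a b c d * ∏ s, N s p,
      (hf.mul (IsPolyFun.prod fun s => ?_)).mul (IsPolyFun.prod hN), fun p hp => ?_⟩
    · refine IsPolyFun.mul ?_ (IsPolyFun.const _)
      exact (IsPolyFun.prod fun i => (IsPolyFun.const 1).sub (IsPolyFun.t.pow _)).mul
        (IsPolyFun.t.pow _)
    · simp only [TBoson.bracket, hform]
      rw [tsum_mul_left, (hsum p hp).tsum_eq, Finset.prod_div_distrib, denom, mul_div_assoc]

lemma isRational_of_mem_normSpan {X : Params n → Module.End ℂ (Fock r)}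
    (hX : X ∈ normSpan fun _ => 2 * n) : IsRational X := by
  refine Submodule.span_induction ?_ ?_ ?_ ?_ hX
  · rintro _ ⟨f, a, b, c, hf, hbc, rfl⟩
    exact isRational_normOp hf hbc
  · have h0 : ∀ (p : Params n) d c,
        formTerm ((0 : Params n → Module.End ℂ (Fock r)) p * twist r p.q) d c = 0 := by
      intro p d c
      simp [formTerm, matrixElement]
    refine ⟨fun p _ => by simp only [h0]; exact summable_zero,
      fun d => ⟨fun _ => 0, IsPolyFun.const 0, fun p _ => ?_⟩⟩
    simp only [TBoson.bracket, h0, tsum_zero, zero_div]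
  · intro X Y _ _ hX hY
    constructor
    · intro p hp
      simp only [Pi.add_apply, add_mul, formTerm_add]
      exact (hX.summable p hp).add (hY.summable p hp)
    · intro d
      obtain ⟨N, hN, H⟩ := hX.bracket d
      obtain ⟨M, hM, H'⟩ := hY.bracket d
      refine ⟨fun p => N p + M p, hN.add hM, fun p hp => ?_⟩
      rw [Pi.add_apply, add_mul, bracket_add (hX.summable p hp) (hY.summable p hp), H p hp,
        H' p hp, add_div]
  · intro a X _ hX
    constructor
    · intro p hp
      simp only [Pi.smul_apply, smul_mul_assoc, formTerm_smul]
      exact (hX.summable p hp).mul_left a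
    · intro d
      obtain ⟨N, hN, H⟩ := hX.bracket d
      refine ⟨fun p => a * N p, (IsPolyFun.const a).mul hN, fun p hp => ?_⟩
      rw [Pi.smul_apply, smul_mul_assoc, bracket_smul, H p hp, mul_div_assoc]

lemma isRational_opAWord (μ : Fin n → Fin (r + 1)) :
    IsRational fun p : Params n => opAWord r p.t p.u p.v μ p.x :=
  isRational_of_mem_normSpan (opAWord_mem_normSpan μ)

end Bracket

/-! ### Rearrangements and multiplicities -/

section Rearrangements
variable {n : ℕ}

lemma sum_unitCharge_apply {r : ℕ} (μ : Fin n → Fin (r + 1)) (i : Fin r) :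
    (∑ k, unitCharge (μ k)) i = (univ.filter fun k => (μ k : ℕ) = (i : ℕ) + 1).card := by
  rw [Finset.sum_apply, Finset.card_filter]
  refine Finset.sum_congr rfl fun k _ => ?_
  simp [unitCharge, Fin.ext_iff]

/-- Two compositions with equal multiplicities are rearrangements of each other. -/
lemma exists_perm_of_card_eq (f g : Fin n → ℕ)
    (h : ∀ j, (univ.filter fun k => f k = j).card = (univ.filter fun k => g k = j).card) :
    ∃ σ : Equiv.Perm (Fin n), ∀ k, f k = g (σ k) := by
  have e : ∀ j, {k // f k = j} ≃ {k // g k = j} := fun j =>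
    Fintype.equivOfCardEq (by rw [Fintype.card_subtype, Fintype.card_subtype, h])
  refine ⟨(Equiv.sigmaFiberEquiv f).symm.trans
    ((Equiv.sigmaCongrRight e).trans (Equiv.sigmaFiberEquiv g)), fun k => ?_⟩
  exact (e (f k) ⟨k, rfl⟩).2.symm

lemma card_filter_zero (f : Fin n → ℕ) (r : ℕ) (hf : ∀ k, f k ≤ r) :
    (univ.filter fun k => f k = 0).card +
      ∑ j ∈ range r, (univ.filter fun k => f k = j + 1).card = n := by
  have h := Finset.card_eq_sum_card_fiberwise (s := (univ : Finset (Fin n))) (f := f)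
    (t := range (r + 1)) fun k _ => by simpa using Nat.lt_succ_of_le (hf k)
  rw [Finset.sum_range_succ', Finset.card_univ, Fintype.card_fin] at h
  omega

/-- The rearrangements of `lam` are characterised by their charge. -/
lemma mem_rearrangements_iff (lam : Fin n → ℕ) (μ : Fin n → Fin (largestPart lam + 1)) :
    μ ∈ rearrangements lam ↔ ∑ k, unitCharge (μ k) = mult (largestPart lam) lam := by
  rw [rearrangements, mem_filter]
  simp only [mem_univ, true_and]
  constructor
  · rintro ⟨σ, hσ⟩
    funext i
    rw [sum_unitCharge_apply, mult, ← Fintype.card_subtype, ← Fintype.card_subtype]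
    exact Fintype.card_congr (σ.subtypeEquiv fun k => by rw [hσ])
  · intro h
    have hle : ∀ k, lam k ≤ largestPart lam := fun k => Finset.le_sup (mem_univ k)
    have hle' : ∀ k, (μ k : ℕ) ≤ largestPart lam := fun k => Nat.lt_succ_iff.1 (μ k).2
    have hpos : ∀ j ∈ range (largestPart lam),
        (univ.filter fun k => (μ k : ℕ) = j + 1).card =
          (univ.filter fun k => lam k = j + 1).card := by
      intro j hj
      have := congrFun h ⟨j, mem_range.1 hj⟩
      rwa [sum_unitCharge_apply] at this
    refine exists_perm_of_card_eq (fun k => (μ k : ℕ)) lam fun j => ?_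
    rcases j with _ | j
    · have h1 := card_filter_zero (fun k => (μ k : ℕ)) _ hle'
      have h2 := card_filter_zero lam _ hle
      rw [Finset.sum_congr rfl hpos] at h1
      omega
    · by_cases hj : j < largestPart lam
      · exact hpos j (mem_range.2 hj)
      · rw [Finset.filter_false_of_mem, Finset.filter_false_of_mem]
        · intro k _ hk
          have := hle k
          omega
        · intro k _ hk
          have := hle' k
          omega

end Rearrangements

/-! ### Words and the polynomials `f_μ` -/

section Words
variable {n : ℕ}

lemma list_prod_ofFn_sum {R ι : Type*} [Semiring R] [Fintype ι] (A : Fin n → ι → R) :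
    (List.ofFn fun k => ∑ a, A k a).prod =
      ∑ μ : Fin n → ι, (List.ofFn fun k => A k (μ k)).prod := by
  induction n with
  | zero => simp
  | succ n ih =>
    rw [List.ofFn_succ, List.prod_cons, ih fun k => A k.succ, Finset.sum_mul_sum,
      ← Fintype.sum_prod_type', ← (Fin.consEquiv fun _ : Fin (n + 1) => ι).sum_comp]
    refine Finset.sum_congr rfl fun x _ => ?_
    rw [List.ofFn_succ, List.prod_cons]
    rfl

lemma wordSum_eq_sum (r : ℕ) (q t u v : ℂ) (x : Fin n → ℂ) :
    wordSum r q t u v x = ∑ μ : Fin n → Fin (r + 1), word r q t u v μ x := by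
  simp only [wordSum, opASum, word]
  rw [list_prod_ofFn_sum, Finset.sum_mul]

lemma list_prod_ofFn_comp_perm {M : Type*} [Monoid M] (A : Fin n → M)
    (h : ∀ i j, Commute (A i) (A j)) (σ : Equiv.Perm (Fin n)) :
    (List.ofFn fun k => A (σ k)).prod = (List.ofFn A).prod := by
  refine List.Perm.prod_eq' (σ.ofFn_comp_perm A) ?_
  rw [List.pairwise_iff_forall_sublist]
  intro a b hab
  have ha := hab.subset (List.mem_cons_self)
  have hb := hab.subset (List.mem_cons_of_mem _ List.mem_cons_self)
  rw [List.mem_ofFn] at ha hb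
  obtain ⟨i, rfl⟩ := ha
  obtain ⟨j, rfl⟩ := hb
  exact h _ _

lemma wordSum_comp_perm (r : ℕ) (q t u v : ℂ) (x : Fin n → ℂ) (σ : Equiv.Perm (Fin n)) :
    wordSum r q t u v (x ∘ σ) = wordSum r q t u v x := by
  rw [wordSum, wordSum]
  congr 1
  exact list_prod_ofFn_comp_perm (fun k => opASum r t u v (x k))
    (fun i j => commute_opASum t u v _ _) σ

/-- Products over lists that differ only in two adjacent factors. -/
lemma exists_list_prod_split {M : Type*} [Monoid M] (F : Fin n → M) {i j : Fin n}
    (hij : (j : ℕ) = i + 1) : ∃ P Q : M, ∀ G : Fin n → M, (∀ k, k ≠ i → k ≠ j → G k = F k) →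
      (List.ofFn G).prod = P * (G i * G j) * Q := by
  induction n with
  | zero => exact i.elim0
  | succ n ih =>
    rcases Fin.eq_zero_or_eq_succ i with rfl | ⟨i', rfl⟩
    · rcases n with _ | n
      · exact absurd j.2 (by rw [hij]; simp)
      · have hj : j = (0 : Fin (n + 1)).succ := Fin.ext (by simpa using hij)
        subst hj
        refine ⟨1, (List.ofFn fun k : Fin n => F k.succ.succ).prod, fun G hG => ?_⟩
        rw [List.ofFn_succ, List.ofFn_succ, List.prod_cons, List.prod_cons, one_mul, mul_assoc]
        congr 4
        funext k
        exact hG _ (Fin.succ_ne_zero _) fun h => Fin.succ_ne_zero _ (Fin.succ_injective _ h)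
    · rcases Fin.eq_zero_or_eq_succ j with rfl | ⟨j', rfl⟩
      · simp at hij
      · obtain ⟨P, Q, h⟩ := ih (fun k => F k.succ) (i := i') (j := j') (by simpa using hij)
        refine ⟨F 0 * P, Q, fun G hG => ?_⟩
        rw [List.ofFn_succ, List.prod_cons, h fun k => G k.succ,
          hG 0 (Fin.succ_ne_zero _).symm (Fin.succ_ne_zero _).symm]
        · simp only [mul_assoc]
        · exact fun k h1 h2 => hG _ (fun h => h1 (Fin.succ_injective _ h))
            fun h => h2 (Fin.succ_injective _ h)

/-- The operators `A_{μ_i}(x_i)` and `A_{μ_j}(x_j)` for adjacent `i, j` in a word; exchanging the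
indices or the variables changes only these two factors. -/
lemma exists_word_split {r : ℕ} (q t u v : ℂ) (μ : Fin n → Fin (r + 1)) (x : Fin n → ℂ)
    {i j : Fin n} (hij : (j : ℕ) = i + 1) : ∃ P Q : Module.End ℂ (Fock r),
      word r q t u v μ x = P * (opA r t u v (μ i) (x i) * opA r t u v (μ j) (x j)) * Q ∧
      word r q t u v μ (x ∘ Equiv.swap i j) =
        P * (opA r t u v (μ i) (x j) * opA r t u v (μ j) (x i)) * Q ∧
      word r q t u v (μ ∘ Equiv.swap i j) x =
        P * (opA r t u v (μ j) (x i) * opA r t u v (μ i) (x j)) * Q := by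
  obtain ⟨P, Q, h⟩ := exists_list_prod_split (fun k => opA r t u v (μ k) (x k)) hij
  refine ⟨P, Q * twist r q, ?_, ?_, ?_⟩
  · rw [word, h _ fun _ _ _ => rfl, mul_assoc]
  · rw [word, h (fun k => opA r t u v (μ k) ((x ∘ Equiv.swap i j) k)), mul_assoc]
    · simp
    · intro k hi hj
      simp [Equiv.swap_apply_of_ne_of_ne hi hj]
  · rw [word, h (fun k => opA r t u v ((μ ∘ Equiv.swap i j) k) (x k)), mul_assoc]
    · simp
    · intro k hi hj
      simp [Equiv.swap_apply_of_ne_of_ne hi hj]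

variable {r : ℕ}

lemma summable_word {q t : ℂ} (u v : ℂ) (h : ConvergenceDomain n q t) (μ : Fin n → Fin (r + 1))
    (x : Fin n → ℂ) : Summable fun dc : (Fin r → ℕ) × TracedConf r =>
      formTerm (word r q t u v μ x) dc.1 dc.2 :=
  (isRational_opAWord μ).summable ⟨q, t, u, v, x⟩ h

lemma formTerm_sum {ι : Type*} (s : Finset ι) (X : ι → Module.End ℂ (Fock r)) (d : Fin r → ℕ)
    (c : TracedConf r) : formTerm (∑ i ∈ s, X i) d c = ∑ i ∈ s, formTerm (X i) d c := by
  simp [formTerm, matrixElement]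

lemma summable_wordSum {q t : ℂ} (u v : ℂ) (h : ConvergenceDomain n q t) (x : Fin n → ℂ) :
    Summable fun dc : (Fin r → ℕ) × TracedConf r =>
      formTerm (wordSum r q t u v x) dc.1 dc.2 := by
  simp only [wordSum_eq_sum, formTerm_sum]
  exact summable_sum fun μ _ => summable_word u v h μ x

lemma bracket_wordSum {q t : ℂ} (u v : ℂ) (h : ConvergenceDomain n q t) (x : Fin n → ℂ)
    (d : Fin r → ℕ) : bracket d (wordSum r q t u v x) =
      ∑ μ : Fin n → Fin (r + 1), bracket d (word r q t u v μ x) := by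
  simp only [bracket, wordSum_eq_sum, formTerm_sum]
  exact Summable.tsum_finsetSum fun μ _ => (summable_word u v h μ x).prod_factor d

lemma bracket_word_eq_zero (q t u v : ℂ) (μ : Fin n → Fin (r + 1)) (x : Fin n → ℂ)
    {d : Fin r → ℕ} (hd : d ≠ ∑ k, unitCharge (μ k)) : bracket d (word r q t u v μ x) = 0 := by
  simp only [bracket, formTerm_word_eq_zero q t u v μ x hd, tsum_zero]

/-- Of the sum over `d` in the linear form only one term remains. -/
lemma fPoly_eq_bracket (q t u v : ℂ) (μ : Fin n → Fin (r + 1)) (x : Fin n → ℂ) :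
    fPoly r q t u v μ x = bracket (∑ k, unitCharge (μ k)) (word r q t u v μ x) :=
  tsum_eq_single _ fun _ hd => bracket_word_eq_zero q t u v μ x hd

lemma sum_unitCharge_comp_swap (μ : Fin n → Fin (r + 1)) (i j : Fin n) :
    ∑ k, unitCharge ((μ ∘ Equiv.swap i j) k) = ∑ k, unitCharge (μ k) :=
  Equiv.sum_comp (Equiv.swap i j) fun k => unitCharge (μ k)

/-- The Hecke relation for a descent is the exchange relation for two adjacent factors. -/
lemma heckeT_fPoly_of_gt {q t : ℂ} (u v : ℂ) (h : ConvergenceDomain n q t)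
    (μ : Fin n → Fin (r + 1)) {i j : Fin n} (hij : (j : ℕ) = i + 1) (hμ : μ j < μ i)
    (x : Fin n → ℂ) (hx : x i ≠ x j) :
    heckeT t i j (fPoly r q t u v μ) x = fPoly r q t u v (μ ∘ Equiv.swap i j) x := by
  obtain ⟨P, Q, h1, h2, h3⟩ := exists_word_split q t u v μ x hij
  have hex := (isExchange_opA (r := r) t u v).gt (x i) (x j) hμ
  have hword : (t * x i - x j) • word r q t u v μ (x ∘ Equiv.swap i j) =
      -((1 - t) * x j) • word r q t u v μ x +
        (x i - x j) • word r q t u v (μ ∘ Equiv.swap i j) x := by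
    have := congrArg (fun X => P * X * Q) hex
    simp only [mul_add, add_mul, mul_smul_comm, smul_mul_assoc] at this
    rw [h1, h2, h3]
    exact this
  have hs : ∀ (a : ℂ) (ν : Fin n → Fin (r + 1)), Summable fun dc : (Fin r → ℕ) × TracedConf r =>
      formTerm (a • word r q t u v ν x) dc.1 dc.2 := by
    intro a ν
    simp only [formTerm_smul]
    exact (summable_word u v h ν x).mul_left a
  have hb := congrArg (bracket (∑ k, unitCharge (μ k))) hword
  rw [bracket_add (hs _ _) (hs _ _), bracket_smul, bracket_smul, bracket_smul,
    ← fPoly_eq_bracket, ← fPoly_eq_bracket, ← sum_unitCharge_comp_swap μ i j,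
    ← fPoly_eq_bracket] at hb
  rw [heckeT]
  have hx' := sub_ne_zero.2 hx
  field_simp
  linear_combination hb

lemma heckeT_fPoly_of_eq (q t u v : ℂ) (μ : Fin n → Fin (r + 1)) {i j : Fin n}
    (hij : (j : ℕ) = i + 1) (hμ : μ i = μ j) (x : Fin n → ℂ) :
    heckeT t i j (fPoly r q t u v μ) x = t * fPoly r q t u v (μ ∘ Equiv.swap i j) x := by
  obtain ⟨P, Q, h1, h2, h3⟩ := exists_word_split q t u v μ x hij
  have hex := (isExchange_opA (r := r) t u v).self (x i) (x j) (μ i)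
  have h21 : word r q t u v μ (x ∘ Equiv.swap i j) = word r q t u v μ x := by
    rw [h1, h2, ← hμ, hex]
  have h31 : word r q t u v (μ ∘ Equiv.swap i j) x = word r q t u v μ x := by
    rw [h1, h3, ← hμ]
  rw [heckeT, fPoly, fPoly, fPoly, h21, h31, sub_self, mul_zero, sub_zero]

lemma PPoly_eq_bracket (lam : Fin n → ℕ) {q t : ℂ} (u v : ℂ) (h : ConvergenceDomain n q t)
    (x : Fin n → ℂ) : PPoly lam q t u v x = Omega lam q t *
      bracket (mult (largestPart lam) lam) (wordSum (largestPart lam) q t u v x) := by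
  rw [PPoly, bracket_wordSum u v h]
  congr 1
  have hzero : ∀ μ ∉ rearrangements lam, bracket (mult (largestPart lam) lam)
      (word (largestPart lam) q t u v μ x) = 0 := fun μ hμ =>
    bracket_word_eq_zero q t u v μ x fun hd => hμ ((mem_rearrangements_iff lam μ).2 hd.symm)
  rw [← Finset.sum_subset (subset_univ (rearrangements lam)) fun μ _ hμ => hzero μ hμ]
  refine Finset.sum_congr rfl fun μ hμ => ?_
  rw [fPoly_eq_bracket, (mem_rearrangements_iff lam μ).1 hμ]

end Words

/-! ### Symmetrization and the common denominator -/

section Symmetrization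
variable {n : ℕ}

lemma evalParams_rename (σ : Equiv.Perm (Fin n))
    (N : MvPolynomial (Fin n) (MvPolynomial (Fin 4) ℂ)) (p : Params n) :
    evalParams p (MvPolynomial.rename σ N) = evalParams ⟨p.q, p.t, p.u, p.v, p.x ∘ σ⟩ N := by
  simp [evalParams, MvPolynomial.map_rename, MvPolynomial.eval_rename]

/-- The average of a polynomial over all permutations of the variables. -/
def symmetrize (N : MvPolynomial (Fin n) (MvPolynomial (Fin 4) ℂ)) :
    MvPolynomial (Fin n) (MvPolynomial (Fin 4) ℂ) :=
  MvPolynomial.C (MvPolynomial.C ((Fintype.card (Equiv.Perm (Fin n)) : ℂ)⁻¹)) *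
    ∑ σ : Equiv.Perm (Fin n), MvPolynomial.rename σ N

lemma isSymmetric_symmetrize (N : MvPolynomial (Fin n) (MvPolynomial (Fin 4) ℂ)) :
    (symmetrize N).IsSymmetric := by
  intro e
  rw [symmetrize, map_mul, MvPolynomial.rename_C, map_sum]
  congr 1
  conv_rhs => rw [← Equiv.sum_comp (Equiv.mulLeft e)]
  refine Finset.sum_congr rfl fun σ _ => ?_
  rw [MvPolynomial.rename_rename]
  rfl

lemma evalParams_symmetrize (N : MvPolynomial (Fin n) (MvPolynomial (Fin 4) ℂ)) (p : Params n)
    (h : ∀ σ : Equiv.Perm (Fin n),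
      evalParams ⟨p.q, p.t, p.u, p.v, p.x ∘ σ⟩ N = evalParams p N) :
    evalParams p (symmetrize N) = evalParams p N := by
  have hC : ∀ a : ℂ, evalParams p (MvPolynomial.C (MvPolynomial.C a)) = a := by
    intro a
    simp [evalParams]
  have hne : (Fintype.card (Equiv.Perm (Fin n)) : ℂ) ≠ 0 := Nat.cast_ne_zero.2 Fintype.card_ne_zero
  rw [symmetrize, map_mul, map_sum, hC]
  simp only [evalParams_rename, h, Finset.sum_const, Finset.card_univ, nsmul_eq_mul]
  rw [inv_mul_cancel_left₀ hne]

/-- `denom` as a polynomial. -/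
def denomPoly (n r : ℕ) : MvPolynomial (Fin 2) ℂ :=
  ∏ s : {s : Fin r × Fin r // s.2 < s.1}, ∏ j ∈ range (2 * n + 1),
    (1 - MvPolynomial.X 0 ^ ((s.1.1 : ℕ) - (s.1.2 : ℕ)) * MvPolynomial.X 1 ^ j)

lemma eval_denomPoly (n r : ℕ) (q t : ℂ) :
    MvPolynomial.eval ![q, t] (denomPoly n r) = denom n r q t := by
  simp [denomPoly, denom, bosonDenom, map_prod]

lemma isPolyFun_Omega (lam : Fin n → ℕ) : IsPolyFun fun p : Params n => Omega lam p.q p.t :=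
  IsPolyFun.prod fun _ => IsPolyFun.prod fun _ =>
    (IsPolyFun.const 1).sub ((IsPolyFun.q.pow _).mul (IsPolyFun.t.pow _))

end Symmetrization

end TBoson

end

theorem mainTheorem2 (n : ℕ) (lam : Fin n → ℕ) (hlam : Antitone lam) :
    -- commutativity of the operators `A(x)`
    (∀ t u v x y : ℂ,
      Commute (opASum (largestPart lam) t u v x) (opASum (largestPart lam) t u v y)) ∧
    (∀ q t u v : ℂ, ConvergenceDomain n q t →
      -- convergence of all the sums that occur
      (∀ (μ : Fin n → Fin (largestPart lam + 1)) (x : Fin n → ℂ),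
        Summable fun dc : (Fin (largestPart lam) → ℕ) × TracedConf (largestPart lam) =>
          formTerm (word (largestPart lam) q t u v μ x) dc.1 dc.2) ∧
      (∀ x : Fin n → ℂ,
        Summable fun dc : (Fin (largestPart lam) → ℕ) × TracedConf (largestPart lam) =>
          formTerm (wordSum (largestPart lam) q t u v x) dc.1 dc.2) ∧
      -- only one term of `⟨θ|` contributes to `f_μ`
      (∀ μ ∈ rearrangements lam, ∀ x : Fin n → ℂ,
        fPoly (largestPart lam) q t u v μ x =
          bracket (mult (largestPart lam) lam) (word (largestPart lam) q t u v μ x)) ∧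
      -- compositions that are not rearrangements of `lam` do not contribute
      (∀ μ ∉ rearrangements lam, ∀ x : Fin n → ℂ,
        bracket (mult (largestPart lam) lam) (word (largestPart lam) q t u v μ x) = 0) ∧
      -- the matrix product formula
      (∀ x : Fin n → ℂ,
        PPoly lam q t u v x =
          Omega lam q t *
            bracket (mult (largestPart lam) lam) (wordSum (largestPart lam) q t u v x)) ∧
      -- the exchange relations
      (∀ μ ∈ rearrangements lam, ∀ i j : Fin n, (j : ℕ) = (i : ℕ) + 1 →
        ∀ x : Fin n → ℂ, x i ≠ x j →
          (μ j < μ i →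
            heckeT t i j (fPoly (largestPart lam) q t u v μ) x =
              fPoly (largestPart lam) q t u v (μ ∘ Equiv.swap i j) x) ∧
          (μ i = μ j →
            heckeT t i j (fPoly (largestPart lam) q t u v μ) x =
              t * fPoly (largestPart lam) q t u v (μ ∘ Equiv.swap i j) x))) ∧
    -- `f_μ` and `P_lam` are polynomials in `x`, with coefficients rational in `q, t` and
    -- polynomial in `u, v`, and `P_lam` is symmetric
    (∃ (D : MvPolynomial (Fin 2) ℂ)
      (F : (Fin n → Fin (largestPart lam + 1)) →
        MvPolynomial (Fin n) (MvPolynomial (Fin 4) ℂ))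
      (P : MvPolynomial (Fin n) (MvPolynomial (Fin 4) ℂ)),
      P.IsSymmetric ∧
      ∀ q t : ℂ, ConvergenceDomain n q t →
        MvPolynomial.eval ![q, t] D ≠ 0 ∧
        ∀ (u v : ℂ) (x : Fin n → ℂ),
          (∀ μ ∈ rearrangements lam,
            fPoly (largestPart lam) q t u v μ x =
              evalAt (F μ) q t u v x / MvPolynomial.eval ![q, t] D) ∧
          PPoly lam q t u v x =
            evalAt P q t u v x / MvPolynomial.eval ![q, t] D) := by
  classical
  refine ⟨commute_opASum, fun q t u v h => ⟨summable_word u v h, summable_wordSum u v h, ?_, ?_, ?_,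
    ?_⟩, ?_⟩
  · intro μ hμ x
    rw [fPoly_eq_bracket, (mem_rearrangements_iff lam μ).1 hμ]
  · intro μ hμ x
    exact bracket_word_eq_zero q t u v μ x fun hd => hμ ((mem_rearrangements_iff lam μ).2 hd.symm)
  · exact PPoly_eq_bracket lam u v h
  · intro μ _ i j hij x hx
    exact ⟨fun hμ => heckeT_fPoly_of_gt u v h μ hij hμ x hx,
      fun hμ => heckeT_fPoly_of_eq q t u v μ hij hμ x⟩
  · choose N hN H using fun μ : Fin n → Fin (largestPart lam + 1) =>
      (isRational_opAWord μ).bracket (∑ k, unitCharge (μ k))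
    choose F hF using hN
    have hfPoly : ∀ q t, ConvergenceDomain n q t → ∀ u v x μ,
        fPoly (largestPart lam) q t u v μ x =
          evalParams ⟨q, t, u, v, x⟩ (F μ) / denom n (largestPart lam) q t := by
      intro q t h u v x μ
      rw [fPoly_eq_bracket, ← hF]
      exact H μ ⟨q, t, u, v, x⟩ h
    obtain ⟨Om, hOm⟩ := isPolyFun_Omega lam
    have hPPoly : ∀ q t, ConvergenceDomain n q t → ∀ u v x, PPoly lam q t u v x =
        evalParams ⟨q, t, u, v, x⟩ (Om * ∑ μ ∈ rearrangements lam, F μ) /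
          denom n (largestPart lam) q t := by
      intro q t h u v x
      rw [PPoly, map_mul, map_sum, ← hOm, mul_div_assoc, Finset.sum_div]
      simp only [hfPoly q t h]
    refine ⟨denomPoly n (largestPart lam), F, symmetrize (Om * ∑ μ ∈ rearrangements lam, F μ),
      isSymmetric_symmetrize _, fun q t h => ⟨?_, fun u v x => ⟨fun μ _ => ?_, ?_⟩⟩⟩
    · rw [eval_denomPoly]
      exact denom_ne_zero h
    · rw [eval_denomPoly]
      exact hfPoly q t h u v x μ
    · rw [eval_denomPoly, evalAt_eq _ (⟨q, t, u, v, x⟩ : Params n), evalParams_symmetrize]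
      · exact hPPoly q t h u v x
      · intro σ
        have hne := denom_ne_zero (r := largestPart lam) h
        have h1 := hPPoly q t h u v (x ∘ σ)
        rw [PPoly_eq_bracket lam u v h, wordSum_comp_perm, ← PPoly_eq_bracket lam u v h,
          hPPoly q t h u v x, div_left_inj' hne] at h1
        exact h1.symm
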